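/- Let $1\le p<\infty$, $0<\theta<p$, and let $(X,d)$ be a complete metric space with a doubling Borel measure $\mu$: $0<\mu(B(x,2r))\le C_\mu\,\mu(B(x,r))<\infty$ for all $x\in X$, $r>0$. Let $\Omega\subset X$ be a uniform domain with $\overline\Omega=X$; that is, $\Omega$ is open, connected, locally compact and not complete, and all $x,y\in\Omega$ are joined by a rectifiable curve $\gamma$ in $\Omega$ with $\ell(\gamma)\le C_U\,d(x,y)$ and $\min\{\ell(\gamma_{[x,z]}),\ell(\gamma_{[z,y]})\}\le C_U\operatorname{dist}(z,X\setminus\Omega)$ for every $z\in\gamma$. Let $\partial\Omega$ be unbounded and uniformly perfect with constant $\kappa>1$ (for all $a\in\partial\Omega$ and $r>0$ with $\partial\Omega\not\subset B(a,r)$, the set $\partial\Omega\cap B(a,\kappa r)\setminus B(a,r)$ is nonempty), and let $\nu$ be a Radon measure on $\partial\Omega$ that is $\theta$-codimensional with respect to $\mu$: for some $C_\theta\ge1$, \[ \frac1{C_\theta}\frac{\mu(B(x,r))}{r^\theta}\le\nu(B(x,r))\le C_\theta\frac{\mu(B(x,r))}{r^\theta}\qquad\text{for all }x\in\partial\Omega,\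 0<r<2\operatorname{diam}(\partial\Omega). \] Fix $b\in\partial\Omega$, write $|x|=d(x,b)$, and let $\rho:(0,\infty)\to(0,\infty)$ be lower semicontinuous such that, for positive constants $C_A,C_B,C_C,C_D$: (A) $\rho(r)\le C_A\,\rho(s)$ whenever $0<r\le 2s+1$ and $0<s\le 2r+1$; (B) $\int_r^\infty\rho(t)\,dt\le C_B(r+1)\rho(r)$ for all $r>0$; (C) $\int_{\Omega\setminus B(b,r)}\rho(|x|)^p\,d\mu(x)\le C_C\,\rho(r)^p\mu(B(b,r+1))$ for all $r>0$; (D) $\int_{\partial\Omega\setminus B(b,r)}\rho(|x|)^{p-\theta}\,d\nu(x)\le C_D\,\rho(r)^{p-\theta}\nu(B(b,r+1))$ for all $r>0$. On $\Omega$ let $d_\rho(x,y)=\inf_\gamma\int_\gamma\rho(|\cdot|)\,ds$, the infimum being over all rectifiable curves $\gamma$ in $\Omega$ joining $x$ and $y$; let $\overline\Omega^{d_\rho}$ be the metric completion of $(\Omega,d_\rho)$, let $\partial_\rho\Omega=\overline\Omega^{d_\rho}\setminus\Omega$, and let $B_\rho(x,r)$ denote the open balls and $\operatorname{diam}_\rho$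 the diameter in $\overline\Omega^{d_\rho}$. A point $z\in\partial\Omega$ is identified with the point of $\partial_\rho\Omega$ that is the limit in $\overline\Omega^{d_\rho}$ of the sequences in $\Omega$ converging to $z$ with respect to $d$ (so that $\partial_\rho\Omega$ consists of $\partial\Omega$ and one further point $\infty$). Let $d\mu_\rho=\rho(|x|)^p\,d\mu$ on $\Omega$ and $d\nu_\rho=\rho(|x|)^{p-\theta}\,d\nu$ on $\partial\Omega\setminus\{b\}$, with $\nu_\rho(\{b\})=\nu_\rho(\{\infty\})=0$, both regarded as Borel measures on $\overline\Omega^{d_\rho}$. Then $\nu_\rho$ is a measure on $\partial_\rho\Omega$ that is $\theta$-codimensional with respect to $\mu_\rho$: both measures are locally finite, $\nu_\rho$ is concentrated on $\partial_\rho\Omega$, and there is a constant $C_{\theta,\rho}\ge1$, depending only on $C_U,C_\mu,p,\theta,C_\theta,\kappa,C_A,C_B,C_C,C_D$, such that \[ \frac1{C_{\theta,\rho}}\frac{\mu_\rho(B_\rho(x,r))}{r^\theta}\le\nu_\rho(B_\rho(x,r))\le C_{\theta,\rho}\frac{\mu_\rho(B_\rho(x,r))}{r^\theta} \] for every $x\in\partial_\rho\Omega$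 (including $\infty$) and every $0<r<2\operatorname{diam}_\rho(\partial_\rho\Omega)$. -/

import Mathlib

open Set Filter Topology MeasureTheory
open scoped ENNReal

namespace Sphericalization

/-! ### Measures and sets in metric spaces -/

/-- `μ` is a doubling measure with constant `C`. -/
def IsDoublingWith {X : Type*} [MetricSpace X] [MeasurableSpace X] (μ : Measure X) (C : ℝ) :
    Prop :=
  1 ≤ C ∧ ∀ (x : X) (r : ℝ), 0 < r →
    0 < μ (Metric.ball x (2 * r)) ∧
    μ (Metric.ball x (2 * r)) ≤ ENNReal.ofReal C * μ (Metric.ball x r) ∧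
    ENNReal.ofReal C * μ (Metric.ball x r) < ∞

/-- The set `A` is uniformly perfect with constant `κ`. -/
def UniformlyPerfectWith {X : Type*} [MetricSpace X] (A : Set X) (κ : ℝ) : Prop :=
  1 < κ ∧ ∀ a ∈ A, ∀ r : ℝ, 0 < r → A ∩ Metric.ball a r ≠ A →
    ((Metric.ball a (κ * r) \ Metric.ball a r) ∩ A).Nonempty

/-- A locally finite Borel measure `ν` living on the set `E` (the boundary of a domain in `Y`)
is `θ`-codimensional, with constant `C`, with respect to the locally finite Borel measure `μ`
on `Y`. -/
structure IsCodimensionalWith {Y : Type*} [MetricSpace Y] [MeasurableSpace Y]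
    (E : Set Y) (μ ν : Measure Y) (θ C : ℝ) : Prop where
  one_le : 1 ≤ C
  locallyFinite_left : IsLocallyFiniteMeasure μ
  locallyFinite_right : IsLocallyFiniteMeasure ν
  concentrated : ν Eᶜ = 0
  bounds : ∀ x ∈ E, ∀ r : ℝ, 0 < r → ENNReal.ofReal r < 2 * Metric.ediam E →
    (ENNReal.ofReal C)⁻¹ * (μ (Metric.ball x r) / ENNReal.ofReal (r ^ θ))
        ≤ ν (Metric.ball x r) ∧
    ν (Metric.ball x r)
        ≤ ENNReal.ofReal C * (μ (Metric.ball x r) / ENNReal.ofReal (r ^ θ))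

/-! ### Rectifiable curves and uniform domains -/

/-- `γ : [0, L] → Ω` is a rectifiable curve in `Ω` of length `L` from `x` to `y`,
parametrized by arc length (as every rectifiable curve can be). -/
structure IsArcLengthCurve {X : Type*} [MetricSpace X] (Ω : Set X) (x y : X) (L : ℝ)
    (γ : ℝ → X) : Prop where
  length_nonneg : 0 ≤ L
  unitSpeed : HasUnitSpeedOn γ (Icc 0 L)
  source : γ 0 = x
  target : γ L = y
  mem : ∀ t ∈ Icc 0 L, γ t ∈ Ω

/-- `Ω` is a uniform domain with constant `C`. -/
structure IsUniformDomainWith {X : Type*} [MetricSpace X] (Ω : Set X) (C : ℝ) : Prop where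
  isOpen : IsOpen Ω
  isConnected : IsConnected Ω
  locallyCompact : LocallyCompactSpace Ω
  not_complete : ¬ IsComplete Ω
  one_le : 1 ≤ C
  exists_curve : ∀ x ∈ Ω, ∀ y ∈ Ω, ∃ (L : ℝ) (γ : ℝ → X), IsArcLengthCurve Ω x y L γ ∧
    L ≤ C * dist x y ∧
    ∀ t ∈ Icc 0 L, min t (L - t) ≤ C * Metric.infDist (γ t) Ωᶜ

/-! ### The conditions on the metric density `ρ : (0, ∞) → (0, ∞)`

Only the values of `ρ` on `(0, ∞)` matter below. -/

/-- `ρ` is a positive lower semicontinuous function on `(0, ∞)`. -/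
def IsMetricDensity (ρ : ℝ → ℝ) : Prop :=
  (∀ r, 0 < r → 0 < ρ r) ∧ LowerSemicontinuousOn ρ (Ioi 0)

/-- Condition (A). -/
def CondA (ρ : ℝ → ℝ) (C : ℝ) : Prop :=
  0 < C ∧ ∀ r s : ℝ, 0 < r → r ≤ 2 * s + 1 → 0 < s → s ≤ 2 * r + 1 → ρ r ≤ C * ρ s

/-- Condition (B). -/
def CondB (ρ : ℝ → ℝ) (C : ℝ) : Prop :=
  0 < C ∧ ∀ r : ℝ, 0 < r →
    ∫⁻ t in Ioi r, ENNReal.ofReal (ρ t) ≤ ENNReal.ofReal (C * (r + 1) * ρ r)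

/-- The integral condition
`∫_{S \ B(b,r)} ρ(|x|)^q dm(x) ≤ C ρ(r)^q m(B(b,r+1))` for all `r > 0`, where `|x| = d(x,b)`.
Condition (C) is the case `S = Ω`, `m = μ`, `q = p`; condition (D) is the case `S = ∂Ω`,
`m = ν`, `q = p - θ`. -/
def IntegralCond {X : Type*} [MetricSpace X] [MeasurableSpace X] (S : Set X) (b : X)
    (m : Measure X) (ρ : ℝ → ℝ) (q C : ℝ) : Prop :=
  0 < C ∧ ∀ r : ℝ, 0 < r →
    ∫⁻ x in S \ Metric.ball b r, ENNReal.ofReal (ρ (dist x b) ^ q) ∂m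
      ≤ ENNReal.ofReal (C * ρ r ^ q) * m (Metric.ball b (r + 1))

/-! ### The sphericalized metric -/

/-- The infimum of `∫_γ ρ(|·|) ds` over all rectifiable curves `γ` in `Ω` from `x` to `y`,
where `|z| = d(z,b)` (with value `∞` if there is no such curve). -/
noncomputable def sphEDist {X : Type*} [MetricSpace X] (Ω : Set X) (b : X) (ρ : ℝ → ℝ)
    (x y : X) : ℝ≥0∞ :=
  ⨅ (L : ℝ) (γ : ℝ → X) (_ : IsArcLengthCurve Ω x y L γ),
    ∫⁻ t in Icc 0 L, ENNReal.ofReal (ρ (dist (γ t) b))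

/-- `Ω` is nonempty and the path distance `d_ρ` is finite on `Ω`. -/
structure FiniteDist {X : Type*} [MetricSpace X] (Ω : Set X) (b : X) (ρ : ℝ → ℝ) : Prop where
  nonempty : Ω.Nonempty
  ne_top : ∀ x ∈ Ω, ∀ y ∈ Ω, sphEDist Ω b ρ x y ≠ ∞

section PathDistance

variable {X : Type*} [MetricSpace X] {Ω : Set X} {b : X} {ρ : ℝ → ℝ}

lemma IsArcLengthCurve.refl {x : X} (hx : x ∈ Ω) : IsArcLengthCurve Ω x x 0 (fun _ => x) where
  length_nonneg := le_rfl
  unitSpeed := hasConstantSpeedOnWith_of_subsingleton _ (by simp) 1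
  source := rfl
  target := rfl
  mem := fun _ _ => hx

lemma IsArcLengthCurve.symm {x y : X} {L : ℝ} {γ : ℝ → X} (h : IsArcLengthCurve Ω x y L γ) :
    IsArcLengthCurve Ω y x L (fun t => γ (L - t)) where
  length_nonneg := h.length_nonneg
  unitSpeed := by
    intro s hs t ht
    have hanti : AntitoneOn (fun u : ℝ => L - u) (Icc 0 L ∩ Icc s t) :=
      fun u _ v _ huv => sub_le_sub_left huv L
    have himg : (fun u : ℝ => L - u) '' (Icc 0 L ∩ Icc s t)
        = Icc 0 L ∩ Icc (L - t) (L - s) := by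
      ext u
      simp only [mem_image, mem_inter_iff, mem_Icc]
      constructor
      · rintro ⟨v, ⟨⟨h1, h2⟩, h3, h4⟩, rfl⟩
        refine ⟨⟨?_, ?_⟩, ?_, ?_⟩ <;> linarith
      · rintro ⟨⟨h1, h2⟩, h3, h4⟩
        refine ⟨L - u, ⟨⟨?_, ?_⟩, ?_, ?_⟩, ?_⟩ <;> linarith
    have := eVariationOn.comp_eq_of_antitoneOn γ (fun u : ℝ => L - u) hanti
    rw [himg] at this
    change eVariationOn (γ ∘ fun u : ℝ => L - u) _ = _
    have hLt : L - t ∈ Icc 0 L := ⟨by linarith [ht.2], by linarith [ht.1]⟩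
    have hLs : L - s ∈ Icc 0 L := ⟨by linarith [hs.2], by linarith [hs.1]⟩
    rw [this]
    refine (h.unitSpeed hLt hLs).trans ?_
    congr 2
    ring
  source := by simpa using h.target
  target := by simpa using h.source
  mem := fun t ht => h.mem _ ⟨by linarith [ht.2], by linarith [ht.1]⟩

lemma hasUnitSpeedOn_congr {f g : ℝ → X} {s : Set ℝ} (hf : HasUnitSpeedOn f s)
    (hfg : EqOn f g s) : HasUnitSpeedOn g s := fun x hx y hy => by
  rw [← hf hx hy]
  exact (eVariationOn.eq_of_eqOn (hfg.mono inter_subset_left)).symm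

lemma hasUnitSpeedOn_shift {f : ℝ → X} {L M : ℝ} (hf : HasUnitSpeedOn f (Icc 0 M)) :
    HasUnitSpeedOn (fun t => f (t - L)) (Icc L (L + M)) := by
  intro s hs t ht
  have hmono : MonotoneOn (fun u : ℝ => u - L) (Icc L (L + M) ∩ Icc s t) :=
    fun u _ v _ huv => by simpa using huv
  have himg : (fun u : ℝ => u - L) '' (Icc L (L + M) ∩ Icc s t)
      = Icc 0 M ∩ Icc (s - L) (t - L) := by
    ext u
    simp only [mem_image, mem_inter_iff, mem_Icc]
    constructor
    · rintro ⟨v, ⟨⟨h1, h2⟩, h3, h4⟩, rfl⟩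
      refine ⟨⟨?_, ?_⟩, ?_, ?_⟩ <;> linarith
    · rintro ⟨⟨h1, h2⟩, h3, h4⟩
      refine ⟨u + L, ⟨⟨?_, ?_⟩, ?_, ?_⟩, ?_⟩ <;> linarith
  have := eVariationOn.comp_eq_of_monotoneOn f (fun u : ℝ => u - L) hmono
  rw [himg] at this
  change eVariationOn (f ∘ fun u : ℝ => u - L) _ = _
  have hsL : s - L ∈ Icc 0 M := ⟨by linarith [hs.1], by linarith [hs.2]⟩
  have htL : t - L ∈ Icc 0 M := ⟨by linarith [ht.1], by linarith [ht.2]⟩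
  rw [this]
  refine (hf hsL htL).trans ?_
  congr 2
  ring

/-- Concatenation of curves. -/
lemma IsArcLengthCurve.trans {x y z : X} {L M : ℝ} {γ δ : ℝ → X}
    (h : IsArcLengthCurve Ω x y L γ) (h' : IsArcLengthCurve Ω y z M δ) :
    IsArcLengthCurve Ω x z (L + M) (fun t => if t ≤ L then γ t else δ (t - L)) where
  length_nonneg := add_nonneg h.length_nonneg h'.length_nonneg
  unitSpeed := by
    refine HasUnitSpeedOn.Icc_Icc (y := L)
      (hasUnitSpeedOn_congr h.unitSpeed fun t ht => by simp [ht.2])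
      (hasUnitSpeedOn_congr (hasUnitSpeedOn_shift h'.unitSpeed) fun t ht => ?_)
    by_cases htL : t ≤ L
    · have : t = L := le_antisymm htL ht.1
      subst this
      simp [h'.source, h.target]
    · simp [htL]
  source := by simp [h.length_nonneg, h.source]
  target := by
    by_cases hM : L + M ≤ L
    · have : M = 0 := le_antisymm (by linarith) h'.length_nonneg
      subst this
      have := h'.source.symm.trans h'.target
      simp [h.target, this]
    · simp only [hM, if_false]
      simpa using h'.target
  mem := by
    intro t ht
    by_cases htL : t ≤ L
    · simpa [htL] using h.mem t ⟨ht.1, htL⟩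
    · simp only [htL, if_false]
      exact h'.mem _ ⟨by linarith, by linarith [ht.2]⟩

lemma sphEDist_self {x : X} (hx : x ∈ Ω) : sphEDist Ω b ρ x x = 0 := by
  refine le_antisymm ?_ bot_le
  refine iInf_le_of_le 0 (iInf_le_of_le (fun _ => x)
    (iInf_le_of_le (IsArcLengthCurve.refl hx) ?_))
  simp

lemma sphEDist_comm_le (x y : X) : sphEDist Ω b ρ x y ≤ sphEDist Ω b ρ y x := by
  refine le_iInf fun L => le_iInf fun γ => le_iInf fun h => ?_
  refine iInf_le_of_le L (iInf_le_of_le _ (iInf_le_of_le h.symm (le_of_eq ?_)))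
  have hmp : MeasurePreserving (fun t : ℝ => L - t) volume volume :=
    Measure.measurePreserving_sub_left volume L
  have hemb : MeasurableEmbedding (fun t : ℝ => L - t) :=
    (MeasurableEquiv.subLeft L).measurableEmbedding
  have := hmp.setLIntegral_comp_preimage_emb hemb
    (fun t => ENNReal.ofReal (ρ (dist (γ t) b))) (Icc 0 L)
  rw [← this]
  congr 2
  simp

lemma sphEDist_triangle (x y z : X) :
    sphEDist Ω b ρ x z ≤ sphEDist Ω b ρ x y + sphEDist Ω b ρ y z := by
  unfold sphEDist
  simp only [ENNReal.iInf_add, ENNReal.add_iInf]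
  refine le_iInf fun M => le_iInf fun δ => le_iInf fun h' => ?_
  refine le_iInf fun L => le_iInf fun γ => le_iInf fun h => ?_
  refine iInf_le_of_le _ (iInf_le_of_le _ (iInf_le_of_le (h.trans h') ?_))
  have hunion : Icc (0 : ℝ) (L + M) ⊆ Icc 0 L ∪ Ioc L (L + M) := by
    intro t ht
    by_cases htL : t ≤ L
    · exact Or.inl ⟨ht.1, htL⟩
    · exact Or.inr ⟨by linarith, ht.2⟩
  refine (lintegral_mono_set hunion).trans ((lintegral_union_le _ _ _).trans ?_)
  refine add_le_add (le_of_eq ?_) ?_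
  · refine setLIntegral_congr_fun measurableSet_Icc fun t ht => ?_
    simp [ht.2]
  · have hmp : MeasurePreserving (fun t : ℝ => t - L) volume volume :=
      measurePreserving_sub_right volume L
    have hemb : MeasurableEmbedding (fun t : ℝ => t - L) :=
      (MeasurableEquiv.subRight L).measurableEmbedding
    rw [← hmp.setLIntegral_comp_preimage_emb hemb
      (fun t => ENNReal.ofReal (ρ (dist (δ t) b))) (Icc 0 M)]
    have hsub : Ioc L (L + M) ⊆ (fun t : ℝ => t - L) ⁻¹' Icc 0 M := by
      intro t ht
      exact ⟨by linarith [ht.1], by linarith [ht.2]⟩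
    refine le_trans (le_of_eq ?_) (lintegral_mono_set hsub)
    refine setLIntegral_congr_fun measurableSet_Ioc fun t ht => ?_
    simp [not_le.2 ht.1]

lemma IsArcLengthCurve.dist_le {x y : X} {L : ℝ} {γ : ℝ → X}
    (h : IsArcLengthCurve Ω x y L γ) {t : ℝ} (ht : t ∈ Icc 0 L) : dist (γ t) x ≤ L := by
  have h1 : edist (γ t) (γ 0) ≤ eVariationOn γ (Icc 0 L ∩ Icc 0 t) :=
    eVariationOn.edist_le γ ⟨ht, ht.1, le_rfl⟩ ⟨⟨le_rfl, h.length_nonneg⟩, le_rfl, ht.1⟩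
  rw [h.unitSpeed ⟨le_rfl, h.length_nonneg⟩ ht, h.source] at h1
  have h2 : edist (γ t) x ≤ ENNReal.ofReal L :=
    h1.trans (ENNReal.ofReal_le_ofReal (by simpa using ht.2))
  rw [edist_dist] at h2
  exact (ENNReal.ofReal_le_ofReal_iff h.length_nonneg).1 h2

lemma CondA.exists_bound {CA : ℝ} (hA : CondA ρ CA) (n : ℕ) :
    ∃ M : ℝ, ∀ r : ℝ, 0 < r → r ≤ 2 ^ n → ρ r ≤ M := by
  induction n with
  | zero =>
    exact ⟨CA * ρ 1, fun r h0 h1 =>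
      hA.2 r 1 h0 (by norm_num at h1; linarith) one_pos (by linarith)⟩
  | succ n ih =>
    obtain ⟨M, hM⟩ := ih
    refine ⟨CA * M, fun r h0 h1 => ?_⟩
    have h2 : ρ (r / 2) ≤ M := hM (r / 2) (by linarith) (by rw [pow_succ] at h1; linarith)
    exact (hA.2 r (r / 2) h0 (by linarith) (by linarith) (by linarith)).trans
      (mul_le_mul_of_nonneg_left h2 hA.1.le)

/-- In a uniform domain the path distance is finite under condition (A). -/
lemma finiteDist {CU CA : ℝ} (hΩ : IsUniformDomainWith Ω CU) (hb : b ∈ frontier Ω)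
    (hA : CondA ρ CA) : FiniteDist Ω b ρ := by
  refine ⟨hΩ.isConnected.nonempty, fun x hx y hy => ?_⟩
  obtain ⟨L, γ, h, -, -⟩ := hΩ.exists_curve x hx y hy
  obtain ⟨n, hn⟩ := pow_unbounded_of_one_lt (L + dist x b) (one_lt_two)
  obtain ⟨M, hM⟩ := hA.exists_bound n
  have hbΩ : b ∉ Ω := by
    rw [hΩ.isOpen.frontier_eq] at hb
    exact hb.2
  refine ne_top_of_le_ne_top ?_ (iInf_le_of_le L (iInf_le_of_le γ (iInf_le_of_le h
    (setLIntegral_mono' measurableSet_Icc (g := fun _ => ENNReal.ofReal M) fun t ht => ?_))))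
  · simp [ENNReal.mul_eq_top]
  · refine ENNReal.ofReal_le_ofReal (hM _ ?_ ?_)
    · exact dist_pos.2 fun hc => hbΩ (hc ▸ h.mem t ht)
    · linarith [dist_triangle (γ t) x b, h.dist_le ht]

end PathDistance

/-! ### The sphericalized space, its boundary and its measures -/

section Space

variable {X : Type*} [MetricSpace X] {Ω : Set X} {b : X} {ρ : ℝ → ℝ}

/-- The set `Ω` equipped with the metric `d_ρ`. -/
def SphDomain (_ : FiniteDist Ω b ρ) : Type _ := Ω

variable (h : FiniteDist Ω b ρ)

instance : Nonempty (SphDomain h) := h.nonempty.to_subtype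

/-- The distance on `SphDomain h` is the path distance `d_ρ`. -/
noncomputable instance : PseudoMetricSpace (SphDomain h) :=
  letI : PseudoEMetricSpace (SphDomain h) :=
    { edist := fun x y => sphEDist Ω b ρ x.1 y.1
      edist_self := fun x => sphEDist_self x.2
      edist_comm := fun x y => le_antisymm (sphEDist_comm_le x.1 y.1) (sphEDist_comm_le y.1 x.1)
      edist_triangle := fun x y z => sphEDist_triangle x.1 y.1 z.1 }
  PseudoEMetricSpace.toPseudoMetricSpace fun x y => h.ne_top x.1 x.2 y.1 y.2

lemma edist_sphDomain (x y : SphDomain h) : edist x y = sphEDist Ω b ρ x.1 y.1 := rfl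

/-- The metric completion of `(Ω, d_ρ)`. -/
noncomputable abbrev SphSpace : Type _ := UniformSpace.Completion (SphDomain h)

noncomputable instance : MeasurableSpace (SphSpace h) := borel _

instance : BorelSpace (SphSpace h) := ⟨rfl⟩

/-- The inclusion of `Ω` into the completion of `(Ω, d_ρ)`. -/
noncomputable def sphCoe (x : Ω) : SphSpace h :=
  UniformSpace.Completion.coe' (show SphDomain h from x)

instance : Nonempty (SphSpace h) := ⟨sphCoe h ⟨_, h.nonempty.some_mem⟩⟩

/-- The boundary `∂_ρ Ω`, the completion of `(Ω, d_ρ)` minus `Ω`. -/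
def sphBoundary : Set (SphSpace h) := (range (sphCoe h))ᶜ

open Classical in
/-- The identification of points of `Ω ∪ ∂Ω` with points of the completion of `(Ω, d_ρ)`:
a point of `Ω` is itself, and `z ∈ ∂Ω` is the limit in the completion of `(Ω, d_ρ)` of points
`x ∈ Ω` that tend to `z` in the original metric. -/
noncomputable def toSph (z : X) : SphSpace h :=
  if hz : z ∈ Ω then sphCoe h ⟨z, hz⟩
  else limUnder (comap (Subtype.val : Ω → X) (𝓝 z)) (sphCoe h)

variable [MeasurableSpace X]

/-- The measure `dμ_ρ = ρ(|x|)^p dμ` on `Ω`, as a measure on the completion of `(Ω, d_ρ)`. -/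
noncomputable def muSph (μ : Measure X) (p : ℝ) : Measure (SphSpace h) :=
  ((μ.restrict Ω).withDensity fun x => ENNReal.ofReal (ρ (dist x b) ^ p)).map (toSph h)

/-- The measure `dν_ρ = ρ(|x|)^(p-θ) dν` on `∂Ω \ {b}`, as a measure on the completion of
`(Ω, d_ρ)`; it gives measure zero to `b` and to the point at infinity. -/
noncomputable def nuSph (ν : Measure X) (p θ : ℝ) : Measure (SphSpace h) :=
  ((ν.restrict (frontier Ω \ {b})).withDensity
    fun x => ENNReal.ofReal (ρ (dist x b) ^ (p - θ))).map (toSph h)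

end Space

end Sphericalization

/-! Write `|x| = d(x,b)` and `tail ρ t = ∫_t^∞ ρ`. Conditions (A) and (B) make `tail ρ t` comparable
to `(t+1) ρ(t+1)`, and they force it to decay geometrically along `t ↦ 2t+1`. The metric `d_ρ` is
then understood at two scales. Near `x`, at distances small against `|x|+1`, it is `ρ(|x|+1)` times
`d`, up to constants (`dist_toSph_le_mul_dist`, `le_dist_toSph`). Globally, `d_ρ(x,y)` is at most a
multiple of the larger tail, and tails of points satisfy a triangle inequality up to constants
(`dist_toSph_le_tail`, `tail_le_add_dist_toSph`). The point at infinity behaves like a point with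
tail zero (`eq_toSph_or_infinity`).

Consequently every ball `U = B_ρ(ξ,r)` centred on the boundary has a reference ball `B(z,s)` with `z
∈ ∂Ω` and a level `v` with `ρ(v) s ≈ r` (`exists_isReference`): either `U` looks like `B(z,s)` with
density about `ρ(v)`, or `U` lies in the far region `|y|+1 ≳ s` and contains a ball comparable to
`B(z,s)` on which the density is bounded below by a multiple of `ρ(v)`. In the far region, (C) and
(D) bound the weighted mass by that of `B(z,s)`. Hence for `(m,q) = (μ|Ω, p)` and `(m,q) = (ν|(∂Ω \
{b}), p-θ)` alike, `∫_U ρ^q dm ≈ ρ(v)^q m(B(z,s))` (`reference_le`, `le_reference`). The doubling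
needed here comes from corkscrew balls for `μ|Ω` and from uniform perfectness for `ν`.

The conclusion is homogeneity: `ρ(v)^p μ(B) / (ρ(v)s)^θ = ρ(v)^(p-θ) μ(B)/s^θ`, and `μ(B)/s^θ ≈
ν(B)` by hypothesis (`codimensional_of_reference`). -/

namespace Sphericalization

/-! ### The density and its tail integral -/

section Density

variable {ρ : ℝ → ℝ} {CA CB : ℝ}

lemma CondA.one_le (hA : CondA ρ CA) (hρ : IsMetricDensity ρ) : 1 ≤ CA := by
  have h1 := hA.2 1 1 one_pos (by norm_num) one_pos (by norm_num)
  have h2 := hρ.1 1 one_pos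
  by_contra! h
  nlinarith

lemma CondA.le_pow (hA : CondA ρ CA) (n : ℕ) {u v : ℝ} (hu : 0 < u) (hv : 0 < v)
    (huv : u ≤ 2 ^ n * v) (hvu : v ≤ 2 ^ n * u) : ρ u ≤ CA ^ n * ρ v := by
  induction n generalizing v with
  | zero =>
    have : u = v := le_antisymm (by simpa using huv) (by simpa using hvu)
    simp [this]
  | succ n ih =>
    have h2 : (1 : ℝ) ≤ 2 ^ n := one_le_pow₀ one_le_two
    rw [pow_succ] at huv hvu
    -- The intermediate point `w` is within a factor `2` of `v` and within a factor `2 ^ n` of `u`.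
    obtain ⟨w, hw, h1, h3, h4, h5⟩ : ∃ w : ℝ, 0 < w ∧ u ≤ 2 ^ n * w ∧ w ≤ 2 ^ n * u ∧
        w ≤ 2 * v ∧ v ≤ 2 * w := by
      rcases le_total u v with h | h
      · refine ⟨max u (v / 2), lt_max_of_lt_left hu, ?_, ?_, ?_, ?_⟩
        · nlinarith [le_max_left u (v / 2)]
        · exact max_le (by nlinarith) (by linarith)
        · exact max_le (by linarith) (by linarith)
        · linarith [le_max_right u (v / 2)]
      · refine ⟨min u (2 * v), lt_min hu (by linarith), ?_, ?_, ?_, ?_⟩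
        · rcases min_choice u (2 * v) with h' | h' <;> rw [h'] <;> nlinarith
        · nlinarith [min_le_left u (2 * v)]
        · exact min_le_right _ _
        · rcases min_choice u (2 * v) with h' | h' <;> rw [h'] <;> linarith
    rw [pow_succ, mul_assoc]
    exact (ih hw h1 h3).trans (mul_le_mul_of_nonneg_left
      (hA.2 w v hw (by linarith) hv (by linarith)) (pow_nonneg hA.1.le n))

/-- The additive `1` in (A) makes `ρ t` and `ρ (t + 1)` comparable down to `t = 0`; comparing `t +
1` with `v` therefore suffices even where `t` itself is tiny. The price is one more factor `CA`. -/
lemma CondA.le_pow_add_one (hA : CondA ρ CA) (n : ℕ) {t v : ℝ} (ht : 0 < t) (hv : 0 < v)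
    (h1 : t + 1 ≤ 2 ^ n * v) (h2 : v ≤ 2 ^ n * (t + 1)) : ρ t ≤ CA ^ (n + 1) * ρ v := by
  have h3 := hA.2 t (t + 1) ht (by linarith) (by linarith) (by linarith)
  have h4 := hA.le_pow n (by linarith : 0 < t + 1) hv h1 h2
  rw [pow_succ', mul_assoc]
  exact h3.trans (mul_le_mul_of_nonneg_left h4 hA.1.le)

lemma CondA.pow_add_one_le (hA : CondA ρ CA) (n : ℕ) {t v : ℝ} (ht : 0 < t) (hv : 0 < v)
    (h1 : t + 1 ≤ 2 ^ n * v) (h2 : v ≤ 2 ^ n * (t + 1)) : ρ v ≤ CA ^ (n + 1) * ρ t := by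
  have h3 := hA.2 (t + 1) t (by linarith) (by linarith) ht (by linarith)
  have h4 := hA.le_pow n hv (by linarith : 0 < t + 1) h2 h1
  rw [pow_succ, mul_assoc]
  exact h4.trans (mul_le_mul_of_nonneg_left h3 (pow_nonneg hA.1.le n))

/-- The tail integral `∫_t^∞ ρ`. -/
noncomputable def tail (ρ : ℝ → ℝ) (t : ℝ) : ℝ :=
  (∫⁻ s in Ioi t, ENNReal.ofReal (ρ s)).toReal

lemma tail_nonneg (t : ℝ) : 0 ≤ tail ρ t := ENNReal.toReal_nonneg

lemma lintegral_Ioc_le (hA : CondA ρ CA) {t : ℝ} (ht : 0 ≤ t) :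
    ∫⁻ s in Ioc t (t + 1), ENNReal.ofReal (ρ s) ≤ ENNReal.ofReal (CA * ρ (t + 1)) := by
  calc ∫⁻ s in Ioc t (t + 1), ENNReal.ofReal (ρ s)
      ≤ ∫⁻ _ in Ioc t (t + 1), ENNReal.ofReal (CA * ρ (t + 1)) :=
        setLIntegral_mono' measurableSet_Ioc fun s hs => ENNReal.ofReal_le_ofReal
          (hA.2 _ _ (ht.trans_lt hs.1) (by linarith [hs.2]) (by linarith) (by linarith [hs.1]))
    _ = ENNReal.ofReal (CA * ρ (t + 1)) := by simp

lemma lintegral_Ioi_eq {s t : ℝ} (hst : s ≤ t) :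
    ∫⁻ u in Ioi s, ENNReal.ofReal (ρ u)
      = (∫⁻ u in Ioc s t, ENNReal.ofReal (ρ u)) + ∫⁻ u in Ioi t, ENNReal.ofReal (ρ u) := by
  rw [← lintegral_union measurableSet_Ioi, Ioc_union_Ioi_eq_Ioi hst]
  exact Set.disjoint_left.2 fun x hx hx' => not_lt.2 hx.2 hx'

/-- Condition (B) is used at `t + 1`, which is positive even for `t = 0`; the unit interval in
between is controlled by (A). -/
lemma lintegral_Ioi_le (hρ : IsMetricDensity ρ) (hA : CondA ρ CA) (hB : CondB ρ CB) {t : ℝ}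
    (ht : 0 ≤ t) : ∫⁻ u in Ioi t, ENNReal.ofReal (ρ u)
      ≤ ENNReal.ofReal ((CA + 2 * CB) * ((t + 1) * ρ (t + 1))) := by
  have h1 : 0 < ρ (t + 1) := hρ.1 _ (by linarith)
  have h2 := hA.1
  have h3 := hB.1
  rw [lintegral_Ioi_eq (show t ≤ t + 1 by linarith)]
  refine (add_le_add (lintegral_Ioc_le hA ht) (hB.2 (t + 1) (by linarith))).trans ?_
  rw [← ENNReal.ofReal_add (by positivity) (by positivity)]
  refine ENNReal.ofReal_le_ofReal ?_
  have h4 : 0 ≤ CA * ρ (t + 1) * t := by positivity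
  have h5 : 0 ≤ CB * ρ (t + 1) * t := by positivity
  nlinarith

lemma lintegral_Ioi_ne_top (hρ : IsMetricDensity ρ) (hA : CondA ρ CA) (hB : CondB ρ CB) {t : ℝ}
    (ht : 0 ≤ t) : ∫⁻ u in Ioi t, ENNReal.ofReal (ρ u) ≠ ∞ :=
  ne_top_of_le_ne_top ENNReal.ofReal_ne_top (lintegral_Ioi_le hρ hA hB ht)

lemma ofReal_tail (hρ : IsMetricDensity ρ) (hA : CondA ρ CA) (hB : CondB ρ CB) {t : ℝ}
    (ht : 0 ≤ t) : ENNReal.ofReal (tail ρ t) = ∫⁻ u in Ioi t, ENNReal.ofReal (ρ u) :=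
  ENNReal.ofReal_toReal (lintegral_Ioi_ne_top hρ hA hB ht)

lemma tail_le (hρ : IsMetricDensity ρ) (hA : CondA ρ CA) (hB : CondB ρ CB) {t : ℝ}
    (ht : 0 ≤ t) : tail ρ t ≤ (CA + 2 * CB) * ((t + 1) * ρ (t + 1)) := by
  have h1 : 0 < ρ (t + 1) := hρ.1 _ (by linarith)
  have h2 := hA.1
  have h3 := hB.1
  exact ENNReal.toReal_le_of_le_ofReal (by positivity) (lintegral_Ioi_le hρ hA hB ht)

lemma tail_antitone (hρ : IsMetricDensity ρ) (hA : CondA ρ CA) (hB : CondB ρ CB) {s t : ℝ}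
    (hs : 0 ≤ s) (hst : s ≤ t) : tail ρ t ≤ tail ρ s :=
  ENNReal.toReal_mono (lintegral_Ioi_ne_top hρ hA hB hs) (lintegral_mono_set (Ioi_subset_Ioi hst))

/-- The interval `(t, 2t+1]` has length `t + 1`, and on it `ρ` is at least `ρ (t + 1) / CA`. -/
lemma le_tail_sub_tail (hρ : IsMetricDensity ρ) (hA : CondA ρ CA) (hB : CondB ρ CB) {t : ℝ}
    (ht : 0 ≤ t) : (t + 1) * ρ (t + 1) ≤ CA * (tail ρ t - tail ρ (2 * t + 1)) := by
  have h1 : 0 < ρ (t + 1) := hρ.1 _ (by linarith)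
  have h2 := hA.1
  have key : ENNReal.ofReal ((t + 1) * (ρ (t + 1) / CA))
      ≤ ∫⁻ u in Ioc t (2 * t + 1), ENNReal.ofReal (ρ u) := by
    calc ENNReal.ofReal ((t + 1) * (ρ (t + 1) / CA))
        = ∫⁻ _ in Ioc t (2 * t + 1), ENNReal.ofReal (ρ (t + 1) / CA) := by
          rw [setLIntegral_const, Real.volume_Ioc, ← ENNReal.ofReal_mul (by positivity), mul_comm]
          congr 2
          ring
      _ ≤ _ := setLIntegral_mono' measurableSet_Ioc fun s hs => ENNReal.ofReal_le_ofReal (by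
          rw [div_le_iff₀' h2]
          exact hA.2 _ _ (by linarith) (by linarith [hs.1]) (ht.trans_lt hs.1)
            (by linarith [hs.2]))
  have h3 : tail ρ t = (∫⁻ u in Ioc t (2 * t + 1), ENNReal.ofReal (ρ u)).toReal
      + tail ρ (2 * t + 1) := by
    have h4 := lintegral_Ioi_ne_top hρ hA hB ht
    rw [lintegral_Ioi_eq (show t ≤ 2 * t + 1 by linarith)] at h4
    rw [tail, lintegral_Ioi_eq (show t ≤ 2 * t + 1 by linarith), ENNReal.toReal_add, tail]
    · exact ne_top_of_le_ne_top h4 le_self_add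
    · exact ne_top_of_le_ne_top h4 le_add_self
  have h4 : (∫⁻ u in Ioc t (2 * t + 1), ENNReal.ofReal (ρ u)) ≠ ∞ :=
    ne_top_of_le_ne_top (lintegral_Ioi_ne_top hρ hA hB ht) (lintegral_mono_set Ioc_subset_Ioi_self)
  have h5 := (ENNReal.ofReal_le_iff_le_toReal h4).1 key
  rw [h3, add_sub_cancel_right]
  calc (t + 1) * ρ (t + 1) = CA * ((t + 1) * (ρ (t + 1) / CA)) := by field_simp
    _ ≤ _ := mul_le_mul_of_nonneg_left h5 h2.le

lemma le_tail (hρ : IsMetricDensity ρ) (hA : CondA ρ CA) (hB : CondB ρ CB) {t : ℝ}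
    (ht : 0 ≤ t) : (t + 1) * ρ (t + 1) ≤ CA * tail ρ t :=
  (le_tail_sub_tail hρ hA hB ht).trans (mul_le_mul_of_nonneg_left
    (by linarith [tail_nonneg (ρ := ρ) (2 * t + 1)]) hA.1.le)

lemma tail_pos (hρ : IsMetricDensity ρ) (hA : CondA ρ CA) (hB : CondB ρ CB) {t : ℝ}
    (ht : 0 ≤ t) : 0 < tail ρ t := by
  have h1 : 0 < (t + 1) * ρ (t + 1) := mul_pos (by linarith) (hρ.1 _ (by linarith))
  exact pos_of_mul_pos_right (h1.trans_le (le_tail hρ hA hB ht)) hA.1.le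

/-- The ratio of geometric decay of the tail integral. -/
noncomputable def tailRatio (CA CB : ℝ) : ℝ := 1 - 1 / (CA * (CA + 2 * CB))

lemma tailRatio_lt_one (hA : 0 < CA) (hB : 0 < CB) : tailRatio CA CB < 1 := by
  unfold tailRatio
  have : 0 < 1 / (CA * (CA + 2 * CB)) := by positivity
  linarith

lemma tailRatio_nonneg (hA : 1 ≤ CA) (hB : 0 < CB) : 0 ≤ tailRatio CA CB := by
  unfold tailRatio
  rw [sub_nonneg, div_le_one (by positivity)]
  nlinarith

/-- The drop of the tail over `(t, 2t+1]` controls `(t+1) ρ(t+1)`, which controls `tail ρ t`; so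
each such step loses a fixed proportion. -/
lemma tail_two_mul_add_one_le (hρ : IsMetricDensity ρ) (hA : CondA ρ CA) (hB : CondB ρ CB)
    {t : ℝ} (ht : 0 ≤ t) : tail ρ (2 * t + 1) ≤ tailRatio CA CB * tail ρ t := by
  have h2 := hA.1
  have h3 := hB.1
  have h4 := le_tail_sub_tail hρ hA hB ht
  have h5 := tail_le hρ hA hB ht
  have h6 : tail ρ t ≤ CA * (CA + 2 * CB) * (tail ρ t - tail ρ (2 * t + 1)) := by
    nlinarith [mul_le_mul_of_nonneg_left h4 (by positivity : 0 ≤ CA + 2 * CB)]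
  rw [← div_le_iff₀' (by positivity)] at h6
  unfold tailRatio
  have h7 : (1 - 1 / (CA * (CA + 2 * CB))) * tail ρ t
    = tail ρ t - tail ρ t / (CA * (CA + 2 * CB)) := by ring
  rw [h7]
  linarith

lemma tail_two_pow_le (hρ : IsMetricDensity ρ) (hA : CondA ρ CA) (hB : CondB ρ CB)
    {t : ℝ} (ht : 0 ≤ t) (m : ℕ) :
    tail ρ (2 ^ m * (t + 1) - 1) ≤ tailRatio CA CB ^ m * tail ρ t := by
  induction m with
  | zero => simp
  | succ m ih =>
    have h1 : (1 : ℝ) ≤ 2 ^ m := one_le_pow₀ one_le_two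
    have h2 : (0 : ℝ) ≤ 2 ^ m * (t + 1) - 1 := by nlinarith
    have h3 := tail_two_mul_add_one_le hρ hA hB h2
    have h4 : 2 ^ (m + 1) * (t + 1) - 1 = 2 * (2 ^ m * (t + 1) - 1) + 1 := by ring
    rw [h4, pow_succ', mul_assoc]
    exact h3.trans (mul_le_mul_of_nonneg_left ih
      (tailRatio_nonneg (hA.one_le hρ) hB.1))

/-- Quantitative inverse of monotonicity: were `t + 1` larger than `2 ^ m * (s + 1)`, the tail at
`t` would have decayed by `tailRatio CA CB ^ m`, too much for the hypothesis. It turns bounds on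
`d_ρ` back into bounds on `|·|`. -/
lemma add_one_le_of_tail_le (hρ : IsMetricDensity ρ) (hA : CondA ρ CA) (hB : CondB ρ CB)
    {C : ℝ} (hC : 0 ≤ C) {m : ℕ} (hm : C * tailRatio CA CB ^ m < 1) {s t : ℝ} (hs : 0 ≤ s)
    (hst : tail ρ s ≤ C * tail ρ t) : t + 1 ≤ 2 ^ m * (s + 1) := by
  by_contra! h
  have h1 : (1 : ℝ) ≤ 2 ^ m := one_le_pow₀ one_le_two
  have h2 := tail_antitone hρ hA hB (by nlinarith : 0 ≤ 2 ^ m * (s + 1) - 1)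
    (by linarith : 2 ^ m * (s + 1) - 1 ≤ t)
  have h3 := tail_two_pow_le hρ hA hB hs m
  have h4 := tail_pos hρ hA hB hs
  have h5 := mul_le_mul_of_nonneg_left (h2.trans h3) hC
  nlinarith

lemma tail_le_of_two_mul_add_one (hρ : IsMetricDensity ρ) (hA : CondA ρ CA) (hB : CondB ρ CB)
    {t : ℝ} (ht : 0 ≤ t) :
    tail ρ t ≤ (CA + 2 * CB) * CA ^ 2 * tail ρ (2 * t + 1) := by
  have hA0 := hA.1
  have hB0 := hB.1
  have h1 := tail_le hρ hA hB ht
  have h2 := le_tail hρ hA hB (by linarith : 0 ≤ 2 * t + 1)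
  have h3 := hA.2 (t + 1) (2 * t + 1 + 1) (by linarith) (by linarith) (by linarith) (by linarith)
  have h4 : 0 < ρ (t + 1) := hρ.1 _ (by linarith)
  calc tail ρ t ≤ (CA + 2 * CB) * ((t + 1) * ρ (t + 1)) := h1
    _ ≤ (CA + 2 * CB) * ((2 * t + 1 + 1) * (CA * ρ (2 * t + 1 + 1))) := by gcongr; linarith
    _ = (CA + 2 * CB) * CA * ((2 * t + 1 + 1) * ρ (2 * t + 1 + 1)) := by ring
    _ ≤ (CA + 2 * CB) * CA * (CA * tail ρ (2 * t + 1)) := by gcongr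
    _ = _ := by ring

/-- Lower semicontinuity serves only this measurability. The indicator removes the irrelevant values
of `ρ` on `(-∞, 0]`. -/
lemma IsMetricDensity.measurable (hρ : IsMetricDensity ρ) :
    Measurable ((Ioi 0).indicator fun t => ENNReal.ofReal (ρ t)) := by
  refine measurable_of_restrict_of_restrict_compl (measurableSet_Ioi (a := (0 : ℝ))) ?_ ?_
  · have h1 : LowerSemicontinuous ((Ioi (0 : ℝ)).domRestrict ρ) := fun x c hc => by
      have h2 := hρ.2 x.1 x.2 c hc
      rw [nhdsWithin_eq_map_subtype_coe x.2] at h2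
      exact h2
    have h2 : (Ioi (0 : ℝ)).domRestrict ((Ioi 0).indicator fun t => ENNReal.ofReal (ρ t))
        = ENNReal.ofReal ∘ (Ioi (0 : ℝ)).domRestrict ρ :=
      funext fun x => indicator_of_mem x.2 _
    rw [h2]
    exact ENNReal.measurable_ofReal.comp h1.measurable
  · have h2 : (Ioi (0 : ℝ))ᶜ.domRestrict ((Ioi 0).indicator fun t => ENNReal.ofReal (ρ t))
        = fun _ => 0 := funext fun x => indicator_of_notMem x.2 _
    rw [h2]
    exact measurable_const

/-- By the intermediate value theorem `f` covers `[u, v]`, and a 1-Lipschitz map does not increase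
one-dimensional Hausdorff measure. So Lebesgue measure on `[u, v]` is dominated by the push-forward
of Lebesgue measure on `[0, L]`. -/
lemma setLIntegral_image_le {f : ℝ → ℝ} {L u v : ℝ} (hL : 0 ≤ L)
    (hf : LipschitzOnWith 1 f (Icc 0 L)) (h0 : f 0 = u) (hv : f L = v) {g : ℝ → ℝ≥0∞}
    (hg : Measurable g) : ∫⁻ t in Icc u v, g t ≤ ∫⁻ t in Icc 0 L, g (f t) := by
  -- Composing with the projection onto `[0, L]` gives a globally continuous, hence measurable,
  -- extension.
  set F : ℝ → ℝ := fun t => f (projIcc 0 L hL t) with hF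
  have hFc : Continuous F :=
    (hf.continuousOn.domRestrict).comp (continuous_projIcc (h := hL))
  have hFf : ∀ t ∈ Icc 0 L, F t = f t := fun t ht => by simp [hF, projIcc_of_mem hL ht]
  have hle : volume.restrict (Icc u v) ≤ (volume.restrict (Icc 0 L)).map F := by
    refine Measure.le_iff.2 fun A hA => ?_
    rw [Measure.restrict_apply hA, Measure.map_apply hFc.measurable hA,
      Measure.restrict_apply (hFc.measurable hA)]
    have hsub : A ∩ Icc u v ⊆ f '' (F ⁻¹' A ∩ Icc 0 L) := by
      rintro y ⟨hyA, hy⟩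
      obtain ⟨t, ht, rfl⟩ := intermediate_value_Icc hL hf.continuousOn (by rwa [h0, hv])
      exact ⟨t, ⟨by rwa [mem_preimage, hFf t ht], ht⟩, rfl⟩
    have h1 := (hf.mono (inter_subset_right (s := F ⁻¹' A))).hausdorffMeasure_image_le
      (zero_le_one (α := ℝ))
    rw [hausdorffMeasure_real] at h1
    simpa using (measure_mono hsub).trans h1
  calc ∫⁻ t in Icc u v, g t ≤ ∫⁻ t, g t ∂((volume.restrict (Icc 0 L)).map F) :=
        lintegral_mono' hle le_rfl
    _ = ∫⁻ t in Icc 0 L, g (F t) := lintegral_map hg hFc.measurable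
    _ = _ := setLIntegral_congr_fun measurableSet_Icc fun t ht => by simp only [hFf t ht]

end Density

/-! ### Estimates of the path distance inside the domain -/

section PathEstimates

variable {X : Type*} [MetricSpace X] {Ω : Set X} {b : X} {ρ : ℝ → ℝ} {CU CA CB : ℝ}

/-- A dense uniform domain, a boundary point and a metric density satisfying the
conditions (A) and (B). -/
structure IsSetting {X : Type*} [MetricSpace X] (Ω : Set X) (b : X) (ρ : ℝ → ℝ)
    (CU CA CB : ℝ) : Prop where
  uniform : IsUniformDomainWith Ω CU
  closure_eq : closure Ω = univ
  mem_frontier : b ∈ frontier Ω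
  density : IsMetricDensity ρ
  condA : CondA ρ CA
  condB : CondB ρ CB

lemma IsArcLengthCurve.lipschitzOnWith {x y : X} {L : ℝ} {γ : ℝ → X}
    (h : IsArcLengthCurve Ω x y L γ) : LipschitzOnWith 1 γ (Icc 0 L) := by
  have key : ∀ s ∈ Icc 0 L, ∀ t ∈ Icc 0 L, s ≤ t → edist (γ s) (γ t) ≤ edist s t := by
    intro s hs t ht hst
    have h1 : edist (γ s) (γ t) ≤ eVariationOn γ (Icc 0 L ∩ Icc s t) :=
      eVariationOn.edist_le γ ⟨hs, le_rfl, hst⟩ ⟨ht, hst, le_rfl⟩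
    rw [h.unitSpeed hs ht] at h1
    rw [edist_dist s t, dist_comm, Real.dist_eq, abs_of_nonneg (sub_nonneg.2 hst)]
    simpa using h1
  intro s hs t ht
  rw [ENNReal.coe_one, one_mul]
  rcases le_total s t with hst | hst
  · exact key s hs t ht hst
  · rw [edist_comm, edist_comm s]
    exact key t ht s hs hst

lemma IsArcLengthCurve.dist_le_of_mem {x y : X} {L : ℝ} {γ : ℝ → X}
    (h : IsArcLengthCurve Ω x y L γ) {t : ℝ} (ht : t ∈ Icc 0 L) : dist (γ t) x ≤ t := by
  have := h.lipschitzOnWith.dist_le_mul t ht 0 ⟨le_rfl, h.length_nonneg⟩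
  simpa [h.source, abs_of_nonneg ht.1] using this

namespace IsSetting

variable (S : IsSetting Ω b ρ CU CA CB)
include S

lemma notMem : b ∉ Ω := by
  have h := S.mem_frontier
  rw [S.uniform.isOpen.frontier_eq] at h
  exact h.2

lemma dist_pos {x : X} (hx : x ∈ Ω) : 0 < dist x b :=
  _root_.dist_pos.2 fun h => S.notMem (h ▸ hx)

lemma mem_frontier_iff {x : X} : x ∈ frontier Ω ↔ x ∉ Ω := by
  rw [S.uniform.isOpen.frontier_eq, S.closure_eq]
  simp

/-- Along a curve from `x` to `y` the function `|·|` is 1-Lipschitz, so the curve pays at least the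
radial cost `∫ ρ` between `|x|` and `|y|`. -/
lemma ofReal_tail_le (x y : X) :
    ENNReal.ofReal (tail ρ (dist x b))
      ≤ ENNReal.ofReal (tail ρ (dist y b)) + sphEDist Ω b ρ x y := by
  rcases le_total (dist y b) (dist x b) with hyx | hxy
  · exact (ENNReal.ofReal_le_ofReal (tail_antitone S.density S.condA S.condB dist_nonneg
      hyx)).trans le_self_add
  · rw [ofReal_tail S.density S.condA S.condB dist_nonneg,
      ofReal_tail S.density S.condA S.condB dist_nonneg, lintegral_Ioi_eq hxy, add_comm]
    refine add_le_add_right (le_iInf fun L => le_iInf fun γ => le_iInf fun h => ?_) _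
    have hlip : LipschitzOnWith 1 (fun t => dist (γ t) b) (Icc 0 L) := by
      have := (LipschitzWith.dist_left b).comp_lipschitzOnWith h.lipschitzOnWith
      rwa [one_mul] at this
    calc ∫⁻ u in Ioc (dist x b) (dist y b), ENNReal.ofReal (ρ u)
        = ∫⁻ u in Ioc (dist x b) (dist y b),
            (Ioi 0).indicator (fun t => ENNReal.ofReal (ρ t)) u :=
          setLIntegral_congr_fun measurableSet_Ioc fun u hu => by
            exact (indicator_of_mem (show u ∈ Ioi (0 : ℝ) from dist_nonneg.trans_lt hu.1)
              fun t => ENNReal.ofReal (ρ t)).symm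
      _ ≤ ∫⁻ u in Icc (dist x b) (dist y b),
            (Ioi 0).indicator (fun t => ENNReal.ofReal (ρ t)) u :=
          lintegral_mono_set Ioc_subset_Icc_self
      _ ≤ ∫⁻ t in Icc 0 L, (Ioi 0).indicator (fun t => ENNReal.ofReal (ρ t)) (dist (γ t) b) :=
          setLIntegral_image_le h.length_nonneg hlip (by rw [h.source]) (by rw [h.target])
            S.density.measurable
      _ ≤ ∫⁻ t in Icc 0 L, ENNReal.ofReal (ρ (dist (γ t) b)) :=
          lintegral_mono fun t => indicator_le_self' (fun _ _ => zero_le) _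

/-- Any curve from `x` to `y` has an initial piece of length `min (d(x,y)) ((|x|+1)/2)`, on which
`|·| + 1` stays within a factor `2` of `|x| + 1`. -/
lemma le_sphEDist (x y : X) :
    ENNReal.ofReal (ρ (dist x b + 1) / CA ^ 2 * min (dist x y) ((dist x b + 1) / 2))
      ≤ sphEDist Ω b ρ x y := by
  refine le_iInf fun L => le_iInf fun γ => le_iInf fun h => ?_
  have hA := S.condA.1
  have hx : 0 ≤ dist x b := dist_nonneg
  have h1 : 0 < ρ (dist x b + 1) := S.density.1 _ (by linarith)
  have hL : dist x y ≤ L := by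
    have := h.dist_le_of_mem ⟨h.length_nonneg, le_rfl⟩
    rwa [h.target, dist_comm] at this
  set l := min (dist x y) ((dist x b + 1) / 2) with hl
  have hlL : l ≤ L := (min_le_left _ _).trans hL
  calc ENNReal.ofReal (ρ (dist x b + 1) / CA ^ 2 * l)
      = ∫⁻ _ in Icc 0 l, ENNReal.ofReal (ρ (dist x b + 1) / CA ^ 2) := by
        rw [setLIntegral_const, Real.volume_Icc, ← ENNReal.ofReal_mul (by positivity), sub_zero]
    _ ≤ ∫⁻ t in Icc 0 l, ENNReal.ofReal (ρ (dist (γ t) b)) := by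
        refine setLIntegral_mono' measurableSet_Icc fun t ht => ENNReal.ofReal_le_ofReal ?_
        have htL : t ∈ Icc 0 L := ⟨ht.1, ht.2.trans hlL⟩
        have h2 := h.dist_le_of_mem htL
        have h3 := ht.2.trans (min_le_right _ _)
        rw [div_le_iff₀' (by positivity)]
        refine S.condA.pow_add_one_le 1 (S.dist_pos (h.mem t htL)) (by linarith) ?_ ?_
        · linarith [dist_triangle (γ t) x b]
        · linarith [dist_triangle_left x b (γ t)]
    _ ≤ _ := lintegral_mono_set (Icc_subset_Icc_right hlL)

lemma sphEDist_le_mul_dist {x y : X} (hx : x ∈ Ω) (hy : y ∈ Ω)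
    (hxy : 2 * (CU * dist x y) ≤ dist x b + 1) :
    sphEDist Ω b ρ x y ≤ ENNReal.ofReal (CA ^ 2 * ρ (dist x b + 1) * (CU * dist x y)) := by
  obtain ⟨L, γ, h, hL, -⟩ := S.uniform.exists_curve x hx y hy
  refine iInf_le_of_le L (iInf_le_of_le γ (iInf_le_of_le h ?_))
  have hx0 : 0 ≤ dist x b := dist_nonneg
  have h1 : 0 < ρ (dist x b + 1) := S.density.1 _ (by linarith)
  have hA := S.condA.1
  calc ∫⁻ t in Icc 0 L, ENNReal.ofReal (ρ (dist (γ t) b))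
      ≤ ∫⁻ _ in Icc 0 L, ENNReal.ofReal (CA ^ 2 * ρ (dist x b + 1)) := by
        refine setLIntegral_mono' measurableSet_Icc fun t ht => ENNReal.ofReal_le_ofReal ?_
        have h2 := h.dist_le_of_mem ht
        have h3 := ht.2
        refine S.condA.le_pow_add_one 1 (S.dist_pos (h.mem t ht)) (by linarith) ?_ ?_
        · linarith [dist_triangle (γ t) x b]
        · linarith [dist_triangle_left x b (γ t)]
    _ = ENNReal.ofReal (CA ^ 2 * ρ (dist x b + 1) * L) := by
        rw [setLIntegral_const, Real.volume_Icc, ← ENNReal.ofReal_mul (by positivity), sub_zero]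
    _ ≤ _ := ENNReal.ofReal_le_ofReal (by gcongr)

/-- If `|γ(t)| ≈ |x| + t`, the density along `γ` is comparable to `ρ` at `|x| + 1 + t`. Translation
turns its integral into one over a subset of `(|x|, ∞)`. -/
lemma lintegral_half_le {γ : ℝ → X} {n : ℕ} {x : X} {l : ℝ}
    (hγ : ∀ t ∈ Icc 0 l, 0 < dist (γ t) b ∧ dist (γ t) b ≤ dist x b + t ∧
      dist x b + t ≤ 2 ^ n * dist (γ t) b) :
    ∫⁻ t in Icc 0 l, ENNReal.ofReal (ρ (dist (γ t) b))
      ≤ ENNReal.ofReal (CA ^ (n + 1) * tail ρ (dist x b)) := by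
  have hA := S.condA.1
  have h2 : (1 : ℝ) ≤ 2 ^ n := one_le_pow₀ one_le_two
  have hmp : MeasurePreserving (fun t : ℝ => (dist x b + 1) + t) volume volume :=
    measurePreserving_add_left volume _
  have hemb : MeasurableEmbedding (fun t : ℝ => (dist x b + 1) + t) :=
    (MeasurableEquiv.addLeft _).measurableEmbedding
  calc ∫⁻ t in Icc 0 l, ENNReal.ofReal (ρ (dist (γ t) b))
      ≤ ∫⁻ t in Icc 0 l, ENNReal.ofReal (CA ^ (n + 1)) *
          ENNReal.ofReal (ρ (dist x b + 1 + t)) := by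
        refine setLIntegral_mono' measurableSet_Icc fun t ht => ?_
        obtain ⟨h3, h4, h5⟩ := hγ t ht
        have h6 : 0 ≤ dist x b := dist_nonneg
        rw [← ENNReal.ofReal_mul (by positivity)]
        refine ENNReal.ofReal_le_ofReal (S.condA.le_pow_add_one n h3 ?_ ?_ ?_)
        · linarith [ht.1]
        · nlinarith [ht.1]
        · nlinarith [ht.1]
    _ = ENNReal.ofReal (CA ^ (n + 1)) *
          ∫⁻ t in Icc 0 l, ENNReal.ofReal (ρ (dist x b + 1 + t)) :=
        lintegral_const_mul' _ _ ENNReal.ofReal_ne_top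
    _ ≤ ENNReal.ofReal (CA ^ (n + 1)) * ∫⁻ t in (fun t : ℝ => (dist x b + 1) + t) ⁻¹'
          Ioi (dist x b), ENNReal.ofReal (ρ (dist x b + 1 + t)) := by
        gcongr
        intro t ht
        simp only [mem_preimage, mem_Ioi]
        linarith [ht.1]
    _ = _ := by
        rw [hmp.setLIntegral_comp_preimage_emb hemb (fun t => ENNReal.ofReal (ρ t)),
          ENNReal.ofReal_mul (by positivity),
          ofReal_tail S.density S.condA S.condB dist_nonneg]

/-- On each half of a uniform curve the arc length `t` from the nearer endpoint is at most `CU`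
times the distance to the complement of `Ω`. Since `b ∉ Ω`, that distance is at most `|γ(t)|`, so
`|γ(t)|` grows linearly and `lintegral_half_le` applies to both halves. -/
lemma sphEDist_le_tail {n : ℕ} (hn : 1 + 2 * CU ≤ 2 ^ n) {x y : X} (hx : x ∈ Ω) (hy : y ∈ Ω) :
    sphEDist Ω b ρ x y
      ≤ ENNReal.ofReal (2 * CA ^ (n + 1) * tail ρ (min (dist x b) (dist y b))) := by
  obtain ⟨L, γ, h, -, hU⟩ := S.uniform.exists_curve x hx y hy
  have hA := S.condA.1
  have hL := h.length_nonneg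
  have hCU := S.uniform.one_le
  have half : ∀ (δ : ℝ → X) (z w : X), IsArcLengthCurve Ω z w L δ →
      (∀ t ∈ Icc 0 L, min t (L - t) ≤ CU * Metric.infDist (δ t) Ωᶜ) →
      min (dist x b) (dist y b) ≤ dist z b →
      ∫⁻ t in Icc 0 (L / 2), ENNReal.ofReal (ρ (dist (δ t) b))
        ≤ ENNReal.ofReal (CA ^ (n + 1) * tail ρ (min (dist x b) (dist y b))) := by
    intro δ z w hδ hUδ hz
    refine (S.lintegral_half_le (n := n) (x := z) fun t ht => ?_).trans
      (ENNReal.ofReal_le_ofReal ?_)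
    · have htL : t ∈ Icc 0 L := ⟨ht.1, by linarith [ht.2]⟩
      have h1 := hUδ t htL
      rw [min_eq_left (by linarith [ht.2])] at h1
      have h2 : Metric.infDist (δ t) Ωᶜ ≤ dist (δ t) b := Metric.infDist_le_dist_of_mem S.notMem
      have h3 := hδ.dist_le_of_mem htL
      have h4 := S.dist_pos (hδ.mem t htL)
      refine ⟨h4, ?_, ?_⟩
      · linarith [dist_triangle (δ t) z b]
      · have h5 := dist_triangle_left z b (δ t)
        have h6 : t ≤ CU * dist (δ t) b := h1.trans (by gcongr)
        nlinarith
    · exact mul_le_mul_of_nonneg_left (tail_antitone S.density S.condA S.condB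
        (le_min dist_nonneg dist_nonneg) hz) (by positivity)
  refine iInf_le_of_le L (iInf_le_of_le γ (iInf_le_of_le h ?_))
  have h1 := half γ x y h hU (min_le_left _ _)
  have h2 := half _ y x h.symm (fun t ht => by
    have := hU (L - t) ⟨by linarith [ht.2], by linarith [ht.1]⟩
    rwa [sub_sub_cancel, min_comm] at this) (min_le_right _ _)
  have hmp : MeasurePreserving (fun t : ℝ => L - t) volume volume :=
    Measure.measurePreserving_sub_left volume L
  have hemb : MeasurableEmbedding (fun t : ℝ => L - t) :=
    (MeasurableEquiv.subLeft L).measurableEmbedding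
  have h3 := hmp.setLIntegral_comp_preimage_emb hemb
    (fun t => ENNReal.ofReal (ρ (dist (γ t) b))) (Icc (L / 2) L)
  have h4 : (fun t : ℝ => L - t) ⁻¹' Icc (L / 2) L = Icc 0 (L / 2) := by
    ext t
    simp only [mem_preimage, mem_Icc]
    constructor <;> rintro ⟨h5, h6⟩ <;> constructor <;> linarith
  rw [h4] at h3
  rw [h3] at h2
  have h5 : Icc (0 : ℝ) L ⊆ Icc 0 (L / 2) ∪ Icc (L / 2) L := fun t ht => by
    rcases le_total t (L / 2) with h | h
    · exact Or.inl ⟨ht.1, h⟩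
    · exact Or.inr ⟨h, ht.2⟩
  refine (lintegral_mono_set h5).trans ((lintegral_union_le _ _ _).trans
    ((add_le_add h1 h2).trans ?_))
  have h6 := tail_nonneg (ρ := ρ) (min (dist x b) (dist y b))
  rw [← ENNReal.ofReal_add (by positivity) (by positivity)]
  exact ENNReal.ofReal_le_ofReal (by linarith)

end IsSetting

end PathEstimates

/-! ### Passage to the completion and its boundary -/

section Boundary

variable {X : Type*} [MetricSpace X] {Ω : Set X} {b : X} {ρ : ℝ → ℝ} {CU CA CB : ℝ}

lemma edist_sphCoe (h : FiniteDist Ω b ρ) (x y : Ω) :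
    edist (sphCoe h x) (sphCoe h y) = sphEDist Ω b ρ x y :=
  UniformSpace.Completion.edist_eq _ _

lemma toSph_of_mem (h : FiniteDist Ω b ρ) {x : X} (hx : x ∈ Ω) :
    toSph h x = sphCoe h ⟨x, hx⟩ := by
  rw [toSph, dif_pos hx]

namespace IsSetting

variable (S : IsSetting Ω b ρ CU CA CB) (h : FiniteDist Ω b ρ)
include S

lemma dist_sphCoe_le_mul_dist {x y : Ω} (hxy : 2 * (CU * dist x y) ≤ dist (x : X) b + 1) :
    dist (sphCoe h x) (sphCoe h y) ≤ CA ^ 2 * CU * (ρ (dist (x : X) b + 1) * dist x y) := by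
  have h1 := S.sphEDist_le_mul_dist x.2 y.2 hxy
  rw [← edist_sphCoe h, edist_dist, ENNReal.ofReal_le_ofReal_iff] at h1
  · exact h1.trans (le_of_eq (by simp only [Subtype.dist_eq]; ring))
  · have := S.density.1 (dist (x : X) b + 1) (by linarith [dist_nonneg (x := (x : X)) (y := b)])
    have := S.uniform.one_le
    positivity

lemma dist_sphCoe_le_tail {n : ℕ} (hn : 1 + 2 * CU ≤ 2 ^ n) (x y : Ω) :
    dist (sphCoe h x) (sphCoe h y)
      ≤ 2 * CA ^ (n + 1) * tail ρ (min (dist (x : X) b) (dist (y : X) b)) := by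
  have h1 := S.sphEDist_le_tail hn x.2 y.2
  have h2 := tail_nonneg (ρ := ρ) (min (dist (x : X) b) (dist (y : X) b))
  have h3 := S.condA.1
  rwa [← edist_sphCoe h, edist_dist, ENNReal.ofReal_le_ofReal_iff (by positivity)] at h1

lemma tail_le_add_dist_sphCoe (x y : Ω) :
    tail ρ (dist (x : X) b) ≤ tail ρ (dist (y : X) b) + dist (sphCoe h x) (sphCoe h y) := by
  have h1 := S.ofReal_tail_le (x : X) y
  rwa [← edist_sphCoe h, edist_dist, ← ENNReal.ofReal_add (tail_nonneg _) dist_nonneg,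
    ENNReal.ofReal_le_ofReal_iff (add_nonneg (tail_nonneg _) dist_nonneg)] at h1

lemma le_dist_sphCoe (x y : Ω) :
    ρ (dist (x : X) b + 1) * min (dist x y) ((dist (x : X) b + 1) / 2)
      ≤ CA ^ 2 * dist (sphCoe h x) (sphCoe h y) := by
  have h1 := S.le_sphEDist (x : X) y
  have h2 := S.condA.1
  rw [← edist_sphCoe h, edist_dist, ENNReal.ofReal_le_ofReal_iff dist_nonneg, div_mul_eq_mul_div,
    div_le_iff₀' (by positivity)] at h1
  exact h1

lemma isDenseInducing_val : IsDenseInducing (Subtype.val : Ω → X) :=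
  ⟨.subtypeVal, by rw [denseRange_subtype_val, dense_iff_closure_eq]; exact S.closure_eq⟩

/-- Near `z` the density is bounded, so `d_ρ` is at most a multiple of `d` on `Ω` there, and the
neighbourhood filter of `z` maps to a Cauchy filter. -/
lemma exists_tendsto_sphCoe (z : X) :
    ∃ c, Tendsto (sphCoe h) (comap (Subtype.val : Ω → X) (𝓝 z)) (𝓝 c) := by
  have : NeBot (comap (Subtype.val : Ω → X) (𝓝 z)) := S.isDenseInducing_val.comap_nhds_neBot z
  have hU := S.uniform.one_le
  have hA := S.condA.1
  obtain ⟨n, hn⟩ := pow_unbounded_of_one_lt (dist z b + 2) (one_lt_two)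
  obtain ⟨M, hM⟩ := S.condA.exists_bound n
  have hM0 : 0 < M := (S.density.1 1 one_pos).trans_le (hM 1 one_pos (one_le_pow₀ one_le_two))
  have hcauchy : Cauchy (map (sphCoe h) (comap (Subtype.val : Ω → X) (𝓝 z))) := by
    rw [Metric.cauchy_iff]
    refine ⟨inferInstance, fun ε hε => ?_⟩
    set δ := min (1 / (4 * CU)) (ε / (4 * (CA ^ 2 * CU * M))) with hδ
    have hδ0 : 0 < δ := by positivity
    have h1 : 4 * CU * δ ≤ 1 := by
      have := min_le_left (1 / (4 * CU)) (ε / (4 * (CA ^ 2 * CU * M)))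
      rwa [le_div_iff₀' (by positivity)] at this
    have h2 : 4 * (CA ^ 2 * CU * M) * δ ≤ ε := by
      have := min_le_right (1 / (4 * CU)) (ε / (4 * (CA ^ 2 * CU * M)))
      rwa [le_div_iff₀' (by positivity)] at this
    refine ⟨sphCoe h '' (Subtype.val ⁻¹' Metric.ball z δ),
      image_mem_map (preimage_mem_comap (Metric.ball_mem_nhds z hδ0)), ?_⟩
    rintro _ ⟨x, hx, rfl⟩ _ ⟨y, hy, rfl⟩
    rw [mem_preimage, Metric.mem_ball] at hx hy
    have hd : dist x y < 2 * δ := by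
      rw [Subtype.dist_eq]
      linarith [dist_triangle_right (x : X) y z]
    have hx0 := S.dist_pos x.2
    have hxb : dist (x : X) b ≤ dist z b + 1 := by
      nlinarith [dist_triangle (x : X) z b]
    have h3 := S.dist_sphCoe_le_mul_dist h (x := x) (y := y) (by nlinarith)
    have h4 : ρ (dist (x : X) b + 1) ≤ M := hM _ (by linarith) (by linarith)
    calc dist (sphCoe h x) (sphCoe h y)
        ≤ CA ^ 2 * CU * (ρ (dist (x : X) b + 1) * dist x y) := h3
      _ ≤ CA ^ 2 * CU * (M * (2 * δ)) := by gcongr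
      _ < ε := by nlinarith
  exact CompleteSpace.complete hcauchy

lemma toSph_eq_extend : toSph h = S.isDenseInducing_val.extend (sphCoe h) := by
  ext z
  by_cases hz : z ∈ Ω
  · rw [toSph_of_mem h hz]
    obtain ⟨c, hc⟩ := S.exists_tendsto_sphCoe h z
    rw [S.isDenseInducing_val.extend_eq_of_tendsto hc]
    have h1 : pure (⟨z, hz⟩ : Ω) ≤ comap (Subtype.val : Ω → X) (𝓝 z) := by
      rintro s ⟨t, ht, hts⟩
      have hzt : z ∈ t := mem_of_mem_nhds ht
      exact hts (show (⟨z, hz⟩ : Ω) ∈ Subtype.val ⁻¹' t from hzt)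
    have h2 := hc.mono_left h1
    exact tendsto_nhds_unique (tendsto_pure_nhds (sphCoe h) _) h2
  · rw [toSph, dif_neg hz]
    rfl

lemma continuous_toSph : Continuous (toSph h) := by
  rw [S.toSph_eq_extend h]
  exact S.isDenseInducing_val.continuous_extend fun z => S.exists_tendsto_sphCoe h z

lemma exists_seq (z : X) : ∃ u : ℕ → Ω, Tendsto (fun n => (u n : X)) atTop (𝓝 z) ∧
    Tendsto (fun n => sphCoe h (u n)) atTop (𝓝 (toSph h z)) := by
  obtain ⟨v, hv, hvz⟩ := mem_closure_iff_seq_limit.1 (S.closure_eq ▸ mem_univ z : z ∈ closure Ω)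
  refine ⟨fun n => ⟨v n, hv n⟩, hvz, ?_⟩
  have h1 := ((S.continuous_toSph h).tendsto z).comp hvz
  refine h1.congr fun n => ?_
  exact toSph_of_mem h (hv n)

lemma exists_seq_dist (x y : X) : ∃ u v : ℕ → Ω,
    Tendsto (fun n => (u n : X)) atTop (𝓝 x) ∧ Tendsto (fun n => (v n : X)) atTop (𝓝 y) ∧
    Tendsto (fun n => dist (u n) (v n)) atTop (𝓝 (dist x y)) ∧
    Tendsto (fun n => dist (u n : X) b) atTop (𝓝 (dist x b)) ∧
    Tendsto (fun n => dist (v n : X) b) atTop (𝓝 (dist y b)) ∧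
    Tendsto (fun n => dist (sphCoe h (u n)) (sphCoe h (v n))) atTop
      (𝓝 (dist (toSph h x) (toSph h y))) := by
  obtain ⟨u, hu, hu'⟩ := S.exists_seq h x
  obtain ⟨v, hv, hv'⟩ := S.exists_seq h y
  exact ⟨u, v, hu, hv, hu.dist hv, hu.dist tendsto_const_nhds, hv.dist tendsto_const_nhds,
    hu'.dist hv'⟩

lemma tail_le_of_le {s t : ℝ} (ht : 0 ≤ t) (hst : s ≤ 2 * t + 1) :
    tail ρ t ≤ (CA + 2 * CB) * CA ^ 2 * tail ρ (max 0 s) := by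
  have hA := S.condA.1
  have hB := S.condB.1
  refine (tail_le_of_two_mul_add_one S.density S.condA S.condB ht).trans
    (mul_le_mul_of_nonneg_left ?_ (by positivity))
  exact tail_antitone S.density S.condA S.condB (le_max_left _ _) (max_le (by linarith) hst)

/-- Limit of the estimate on `Ω`. The hypothesis is strict so that approximating points inherit it;
the extra `CA` compares `ρ` at the approximants with `ρ` at `x`, as `ρ` need not be continuous. -/
lemma dist_toSph_le_mul_dist {x y : X} (hxy : 2 * (CU * dist x y) < dist x b + 1) :
    dist (toSph h x) (toSph h y) ≤ CA ^ 3 * CU * (ρ (dist x b + 1) * dist x y) := by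
  obtain ⟨u, v, -, -, huv, hub, -, hd⟩ := S.exists_seq_dist h x y
  have hU := S.uniform.one_le
  have hA := S.condA.1
  have h0 : 0 ≤ dist x b := dist_nonneg
  have h1 : ∀ᶠ n in atTop, 2 * (CU * dist (u n) (v n)) < dist (u n : X) b + 1 :=
    ((huv.const_mul CU).const_mul 2).eventually_lt (hub.add_const 1) hxy
  have h2 : ∀ᶠ n in atTop, dist (u n : X) b < 2 * dist x b + 1 :=
    hub.eventually_lt_const (by linarith)
  have h3 : ∀ᶠ n in atTop, dist x b < 2 * dist (u n : X) b + 1 :=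
    tendsto_const_nhds.eventually_lt ((hub.const_mul 2).add_const 1) (by linarith)
  refine le_of_tendsto_of_tendsto hd ((huv.const_mul _).const_mul _) ?_
  filter_upwards [h1, h2, h3] with n h1 h2 h3
  have hu0 := S.dist_pos (u n).2
  have h4 := S.condA.2 (dist (u n : X) b + 1) (dist x b + 1) (by linarith) (by linarith)
    (by linarith) (by linarith)
  calc dist (sphCoe h (u n)) (sphCoe h (v n))
      ≤ CA ^ 2 * CU * (ρ (dist (u n : X) b + 1) * dist (u n) (v n)) :=
        S.dist_sphCoe_le_mul_dist h h1.le
    _ ≤ CA ^ 2 * CU * (CA * ρ (dist x b + 1) * dist (u n) (v n)) := by gcongr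
    _ = _ := by ring

/-- The constant in the upper bound of the sphericalized distance by the tail integral. -/
noncomputable def _root_.Sphericalization.tailConst (CA CB : ℝ) (n : ℕ) : ℝ :=
  2 * CA ^ (n + 1) * ((CA + 2 * CB) * CA ^ 2)

lemma dist_toSph_le_tail {n : ℕ} (hn : 1 + 2 * CU ≤ 2 ^ n) (x y : X) :
    dist (toSph h x) (toSph h y)
      ≤ tailConst CA CB n * tail ρ (min (dist x b) (dist y b)) := by
  obtain ⟨u, v, -, -, -, hub, hvb, hd⟩ := S.exists_seq_dist h x y
  have hA := S.condA.1
  have h1 : ∀ᶠ n in atTop, min (dist x b) (dist y b)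
      < 2 * min (dist (u n : X) b) (dist (v n : X) b) + 1 :=
    tendsto_const_nhds.eventually_lt (((hub.min hvb).const_mul 2).add_const 1)
      (by linarith [le_min (dist_nonneg (x := x) (y := b)) (dist_nonneg (x := y) (y := b))])
  refine le_of_tendsto hd ?_
  filter_upwards [h1] with k hk
  have h2 := S.tail_le_of_le (le_min dist_nonneg dist_nonneg) hk.le
  rw [max_eq_right (le_min dist_nonneg dist_nonneg)] at h2
  refine (S.dist_sphCoe_le_tail h hn (u k) (v k)).trans ?_
  rw [tailConst, mul_assoc (2 * CA ^ (n + 1))]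
  exact mul_le_mul_of_nonneg_left h2 (by positivity)

lemma one_le_tail_factor : 1 ≤ (CA + 2 * CB) * CA ^ 2 := by
  have h1 := S.condA.one_le S.density
  have h2 := S.condB.1
  exact one_le_mul_of_one_le_of_one_le (by linarith) (one_le_pow₀ h1)

lemma tail_le_add_dist_toSph (x y : X) :
    tail ρ (dist x b) ≤ ((CA + 2 * CB) * CA ^ 2) ^ 2 *
      (tail ρ (dist y b) + dist (toSph h x) (toSph h y)) := by
  obtain ⟨u, v, -, -, -, hub, hvb, hd⟩ := S.exists_seq_dist h x y
  set D := (CA + 2 * CB) * CA ^ 2 with hD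
  have hD1 : 1 ≤ D := S.one_le_tail_factor
  have hx : 0 ≤ dist x b := dist_nonneg
  have hy : 0 ≤ dist y b := dist_nonneg
  have h1 : ∀ᶠ n in atTop, dist (u n : X) b < 2 * dist x b + 1 :=
    hub.eventually_lt_const (by linarith)
  have h2 : ∀ᶠ n in atTop, dist y b < 2 * dist (v n : X) b + 1 :=
    tendsto_const_nhds.eventually_lt ((hvb.const_mul 2).add_const 1) (by linarith)
  refine ge_of_tendsto ((hd.const_add _).const_mul _) ?_
  filter_upwards [h1, h2] with n h1 h2
  have h3 := S.tail_le_of_le hx h1.le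
  have h4 := S.tail_le_of_le dist_nonneg h2.le
  rw [max_eq_right dist_nonneg] at h3 h4
  have h5 := S.tail_le_add_dist_sphCoe h (u n) (v n)
  have h6 : dist (sphCoe h (u n)) (sphCoe h (v n)) ≤ D * dist (sphCoe h (u n)) (sphCoe h (v n)) :=
    le_mul_of_one_le_left dist_nonneg hD1
  calc tail ρ (dist x b) ≤ D * tail ρ (dist (u n : X) b) := h3
    _ ≤ D * (D * tail ρ (dist y b) + D * dist (sphCoe h (u n)) (sphCoe h (v n))) := by
        gcongr
        linarith
    _ = _ := by ring

lemma le_dist_toSph (x y : X) :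
    ρ (dist x b + 1) * min (dist x y) ((dist x b + 1) / 2)
      ≤ CA ^ 3 * dist (toSph h x) (toSph h y) := by
  obtain ⟨u, v, -, -, huv, hub, -, hd⟩ := S.exists_seq_dist h x y
  have hA := S.condA.1
  have h0 : 0 ≤ dist x b := dist_nonneg
  have h2 : ∀ᶠ n in atTop, dist (u n : X) b < 2 * dist x b + 1 :=
    hub.eventually_lt_const (by linarith)
  have h3 : ∀ᶠ n in atTop, dist x b < 2 * dist (u n : X) b + 1 :=
    tendsto_const_nhds.eventually_lt ((hub.const_mul 2).add_const 1) (by linarith)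
  refine le_of_tendsto_of_tendsto ((huv.min ((hub.add_const 1).div_const 2)).const_mul _)
    (hd.const_mul _) ?_
  filter_upwards [h2, h3] with n h2 h3
  have hu0 := S.dist_pos (u n).2
  have h4 := S.condA.2 (dist x b + 1) (dist (u n : X) b + 1) (by linarith) (by linarith)
    (by linarith) (by linarith)
  have h5 := S.le_dist_sphCoe h (u n) (v n)
  have h6 : 0 ≤ min (dist (u n) (v n)) ((dist (u n : X) b + 1) / 2) :=
    le_min dist_nonneg (by linarith)
  calc ρ (dist x b + 1) * min (dist (u n) (v n)) ((dist (u n : X) b + 1) / 2)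
      ≤ CA * ρ (dist (u n : X) b + 1) * min (dist (u n) (v n)) ((dist (u n : X) b + 1) / 2) := by
        gcongr
    _ ≤ CA * (CA ^ 2 * dist (sphCoe h (u n)) (sphCoe h (v n))) := by
        rw [mul_assoc]
        gcongr
    _ = _ := by ring

lemma tendsto_tail : Tendsto (tail ρ) atTop (𝓝 0) := by
  have hA := S.condA.one_le S.density
  have hB := S.condB.1
  have h1 : Tendsto (fun m : ℕ => tailRatio CA CB ^ m * tail ρ 0) atTop (𝓝 0) := by
    simpa using (tendsto_pow_atTop_nhds_zero_of_lt_one (tailRatio_nonneg hA hB)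
      (tailRatio_lt_one (by linarith) hB)).mul_const (tail ρ 0)
  rw [Metric.tendsto_atTop]
  intro ε hε
  obtain ⟨m, hm⟩ := (h1.eventually_lt_const hε).exists
  refine ⟨2 ^ m * (0 + 1) - 1, fun t ht => ?_⟩
  have h2 : (1 : ℝ) ≤ 2 ^ m := one_le_pow₀ one_le_two
  rw [Real.dist_0_eq_abs, abs_of_nonneg (tail_nonneg _)]
  exact ((tail_antitone S.density S.condA S.condB (by linarith) ht).trans
    (tail_two_pow_le S.density S.condA S.condB le_rfl m)).trans_lt hm

/-- A point of the completion is either a point of the original space, or it lies at infinity. -/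
lemma eq_toSph_or_infinity [CompleteSpace X] {n : ℕ} (hn : 1 + 2 * CU ≤ 2 ^ n) (ξ : SphSpace h) :
    (∃ z, toSph h z = ξ) ∨ ∀ y, dist (toSph h y) ξ ≤ tailConst CA CB n * tail ρ (dist y b) ∧
      tail ρ (dist y b) ≤ ((CA + 2 * CB) * CA ^ 2) ^ 2 * dist (toSph h y) ξ := by
  have hdense : DenseRange (sphCoe h) :=
    UniformSpace.Completion.denseRange_coe (α := SphDomain h)
  obtain ⟨w, hw, hwξ⟩ := mem_closure_iff_seq_limit.1 (hdense ξ)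
  choose u hu using hw
  have huξ : Tendsto (fun k => toSph h (u k)) atTop (𝓝 ξ) := by
    refine hwξ.congr fun k => ?_
    rw [toSph_of_mem h (u k).2, ← hu k]
  -- If `|u k|` tends to infinity, the estimates survive in the limit with tail zero at `ξ`.
  -- Otherwise a subsequence is bounded in `d`.
  by_cases hlim : Tendsto (fun k => dist (u k : X) b) atTop atTop
  · right
    intro y
    have h1 : Tendsto (fun k => dist (toSph h y) (toSph h (u k))) atTop (𝓝 (dist (toSph h y) ξ)) :=
      tendsto_const_nhds.dist huξ
    constructor
    · refine le_of_tendsto h1 ?_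
      filter_upwards [hlim.eventually_ge_atTop (dist y b)] with k hk
      simpa [min_eq_left hk] using S.dist_toSph_le_tail h hn y (u k)
    · have h2 : Tendsto (fun k => tail ρ (dist (u k : X) b)) atTop (𝓝 0) :=
        S.tendsto_tail.comp hlim
      have h3 := (h2.add h1).const_mul (((CA + 2 * CB) * CA ^ 2) ^ 2)
      rw [zero_add] at h3
      exact ge_of_tendsto' h3 fun k => S.tail_le_add_dist_toSph h y (u k)
  · left
    rw [tendsto_atTop_atTop] at hlim
    push Not at hlim
    obtain ⟨R, hR⟩ := hlim
    have hfreq : ∃ᶠ k in atTop, dist (u k : X) b < R := by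
      rw [frequently_atTop]
      exact hR
    obtain ⟨φ, hφ, hφR⟩ := extraction_of_frequently_atTop hfreq
    have hR0 : 0 < R := dist_nonneg.trans_lt (hφR 0)
    obtain ⟨j, hj⟩ := pow_unbounded_of_one_lt (R + 1) (one_lt_two)
    have hA := S.condA.1
    -- On the bounded subsequence `ρ` is bounded below, so `le_dist_toSph` makes it Cauchy in `d`;
    -- completeness of `X` then gives its limit.
    have hlow : ∀ k, ρ 1 ≤ CA ^ j * ρ (dist (u (φ k) : X) b + 1) := fun k => by
      have := hφR k
      have h0 : 0 ≤ dist (u (φ k) : X) b := dist_nonneg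
      have h1 : (1 : ℝ) ≤ 2 ^ j := one_le_pow₀ one_le_two
      exact S.condA.le_pow j one_pos (by linarith) (by nlinarith) (by linarith)
    have hρ1 := S.density.1 1 one_pos
    have hC := (huξ.comp hφ.tendsto_atTop).cauchySeq
    have hC' : CauchySeq fun k => (u (φ k) : X) := by
      rw [Metric.cauchySeq_iff] at hC ⊢
      intro ε hε
      -- The cap `1 / 2` lies below `(|x| + 1) / 2`, so it bounds the minimum in `le_dist_toSph`.
      set c := min ε (1 / 2) with hc
      have hc0 : 0 < c := by positivity
      obtain ⟨N, hN⟩ := hC (ρ 1 * c / (CA ^ j * CA ^ 3)) (by positivity)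
      refine ⟨N, fun k hk l hl => ?_⟩
      have h1 := hN k hk l hl
      rw [lt_div_iff₀' (by positivity)] at h1
      have h2 := S.le_dist_toSph h (u (φ k) : X) (u (φ l))
      by_contra! hcon
      have h3 : c ≤ min (dist (u (φ k) : X) (u (φ l))) ((dist (u (φ k) : X) b + 1) / 2) :=
        le_min ((min_le_left _ _).trans hcon) ((min_le_right _ _).trans
          (by linarith [dist_nonneg (x := (u (φ k) : X)) (y := b)]))
      have h4 : ρ 1 * c ≤ CA ^ j * (CA ^ 3 * dist (toSph h (u (φ k))) (toSph h (u (φ l)))) := by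
        refine le_trans ?_ (mul_le_mul_of_nonneg_left h2 (by positivity))
        rw [← mul_assoc]
        exact mul_le_mul (hlow k) h3 hc0.le (hρ1.le.trans (hlow k))
      rw [← mul_assoc] at h4
      exact absurd h1 (not_lt.2 h4)
    obtain ⟨z, hz⟩ := cauchySeq_tendsto_of_complete hC'
    exact ⟨z, tendsto_nhds_unique (((S.continuous_toSph h).tendsto z).comp hz)
      (huξ.comp hφ.tendsto_atTop)⟩

lemma toSph_injective : Function.Injective (toSph h) := by
  intro x y hxy
  have h1 := S.le_dist_toSph h x y
  have h0 : 0 ≤ dist x b := dist_nonneg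
  have h2 := S.density.1 (dist x b + 1) (by linarith)
  rw [hxy, dist_self, mul_zero] at h1
  have h3 := nonpos_of_mul_nonpos_right h1 h2
  rcases min_le_iff.1 h3 with h4 | h4
  · exact dist_le_zero.1 h4
  · linarith

lemma toSph_mem_sphBoundary {z : X} : toSph h z ∈ sphBoundary h ↔ z ∈ frontier Ω := by
  rw [S.mem_frontier_iff, sphBoundary, mem_compl_iff, not_iff_not]
  constructor
  · rintro ⟨x, hx⟩
    rw [← toSph_of_mem h x.2] at hx
    exact S.toSph_injective h hx ▸ x.2
  · intro hz
    exact ⟨⟨z, hz⟩, (toSph_of_mem h hz).symm⟩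

/-- Makes the boundary measurable. The tail bound keeps a small `d_ρ`-ball away from infinity, and
the local lower bound keeps it inside a `d`-ball contained in `Ω`. -/
lemma isOpen_range_sphCoe [CompleteSpace X] : IsOpen (range (sphCoe h)) := by
  obtain ⟨n, hn⟩ := pow_unbounded_of_one_lt (1 + 2 * CU) (one_lt_two)
  rw [Metric.isOpen_iff]
  rintro _ ⟨x, rfl⟩
  obtain ⟨δ, hδ, hball⟩ := Metric.isOpen_iff.1 S.uniform.isOpen x x.2
  have hD := zero_lt_one.trans_le S.one_le_tail_factor
  have hA := S.condA.1
  have hx0 := S.dist_pos x.2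
  have ht := tail_pos S.density S.condA S.condB hx0.le
  have hρ := S.density.1 (dist (x : X) b + 1) (by linarith)
  set c := min δ ((dist (x : X) b + 1) / 2) with hc
  have hc0 : 0 < c := by positivity
  refine ⟨min (tail ρ (dist (x : X) b) / ((CA + 2 * CB) * CA ^ 2) ^ 2)
    (ρ (dist (x : X) b + 1) * c / CA ^ 3), by positivity, fun ξ hξ => ?_⟩
  rw [Metric.mem_ball', lt_min_iff, lt_div_iff₀' (by positivity), lt_div_iff₀' (by positivity),
    ← toSph_of_mem h x.2] at hξ
  rcases S.eq_toSph_or_infinity h hn.le ξ with ⟨z, rfl⟩ | hinf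
  · have h1 := (S.le_dist_toSph h x z).trans_lt hξ.2
    have h2 := lt_of_mul_lt_mul_left h1 hρ.le
    have h3 : dist (x : X) z < δ := by
      by_contra! hcon
      exact absurd h2 (not_lt.2 (min_le_min_right _ hcon))
    have hz : z ∈ Ω := hball (Metric.mem_ball'.2 h3)
    exact ⟨⟨z, hz⟩, (toSph_of_mem h hz).symm⟩
  · exact absurd (hinf x).2 (not_le.2 hξ.1)

end IsSetting

end Boundary

/-! ### Reference balls for balls of the sphericalized metric -/

section Reference

variable {X : Type*} [MetricSpace X] {Ω : Set X} {b : X} {ρ : ℝ → ℝ} {CU CA CB κ : ℝ}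

/-- The ball `B(z, s)` in the original metric is a reference for the set `U` (a ball of radius `r`
in the sphericalized metric): `U` contains a ball comparable to `B(z, s)` on which the density is
at least comparable to `ρ v ≈ r / s`, and `U` is either contained in a multiple of `B(z, s)`, with
density bounded by a multiple of `ρ v`, or in the complement of a ball centred at `b` comparable to
`B(z, s)`. -/
structure IsReference (F U : Set X) (b : X) (ρ : ℝ → ℝ) (CA c : ℝ) (N : ℕ) (r : ℝ) (z a : X)
    (s v : ℝ) : Prop where
  center_mem : z ∈ F
  inner_mem : a ∈ F
  radius_pos : 0 < s
  level_pos : 0 < v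
  le_mul : r ≤ c * (ρ v * s)
  mul_le : ρ v * s ≤ c * r
  inner_subset : Metric.ball a (s / 2 ^ N) ⊆ U
  dist_inner_le : dist a z ≤ 2 ^ N * s
  le_density : ∀ y ∈ Metric.ball a (s / 2 ^ N), y ≠ b → ρ v ≤ CA ^ (N + 1) * ρ (dist y b)
  upper : (∀ y ∈ U, dist y z < 2 ^ N * s ∧ (y ≠ b → ρ (dist y b) ≤ CA ^ (N + 1) * ρ v)) ∨
    (1 ≤ s ∧ v = s ∧ dist z b ≤ s ∧ ∀ y ∈ U, s ≤ 2 ^ N * (dist y b + 1))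

/-- The admissible exponents `N` in `IsReference`. -/
structure IsScale (CU CA CB κ : ℝ) (n N : ℕ) : Prop where
  uniform_le : 1 + 2 * CU ≤ 2 ^ n
  le_two_pow : 4 * (CA ^ 6 * CU) + 2 * κ + 2 ≤ 2 ^ N
  decay : 4 * ((CA + 2 * CB) * CA ^ 2) ^ 3 * (1 + tailConst CA CB n) * tailRatio CA CB ^ N < 1

/-- The comparison constant between `r` and `ρ v * s` in `IsReference`. -/
noncomputable def scaleConst (CA CB : ℝ) (n : ℕ) : ℝ :=
  4 * CA ^ 3 + 2 * tailConst CA CB n * ((CA + 2 * CB) * CA ^ 2) * (CA + 2 * CB)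

lemma exists_isScale (hA : 1 ≤ CA) (hB : 0 < CB) : ∃ n N, IsScale CU CA CB κ n N := by
  obtain ⟨n, hn⟩ := pow_unbounded_of_one_lt (1 + 2 * CU) (one_lt_two)
  have h1 : Tendsto (fun N : ℕ => 4 * ((CA + 2 * CB) * CA ^ 2) ^ 3 * (1 + tailConst CA CB n) *
      tailRatio CA CB ^ N) atTop (𝓝 0) := by
    simpa using (tendsto_pow_atTop_nhds_zero_of_lt_one (tailRatio_nonneg hA hB)
      (tailRatio_lt_one (by linarith) hB)).const_mul
      (4 * ((CA + 2 * CB) * CA ^ 2) ^ 3 * (1 + tailConst CA CB n))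
  have h2 : Tendsto (fun N : ℕ => (2 : ℝ) ^ N) atTop atTop :=
    tendsto_pow_atTop_atTop_of_one_lt one_lt_two
  obtain ⟨N, h3, h4⟩ := ((h1.eventually_lt_const one_pos).and (h2.eventually_ge_atTop
    (4 * (CA ^ 6 * CU) + 2 * κ + 2))).exists
  exact ⟨n, N, hn.le, h4, h3⟩

namespace IsSetting

variable (S : IsSetting Ω b ρ CU CA CB) (h : FiniteDist Ω b ρ) {n N : ℕ}
include S

lemma one_le_tailConst : 1 ≤ tailConst CA CB n := by
  have h1 := S.one_le_tail_factor
  have h2 : 1 ≤ CA ^ (n + 1) := one_le_pow₀ (S.condA.one_le S.density)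
  unfold tailConst
  nlinarith

lemma one_le_scaleConst : 1 ≤ scaleConst CA CB n := by
  have h0 := S.condA.1
  have hB := S.condB.1
  have h1 : 1 ≤ CA ^ 3 := one_le_pow₀ (S.condA.one_le S.density)
  have h2 := S.one_le_tailConst (n := n)
  have h3 : 0 ≤ 2 * tailConst CA CB n * ((CA + 2 * CB) * CA ^ 2) * (CA + 2 * CB) := by positivity
  unfold scaleConst
  linarith

/-- Here `r` is small against `(|z|+1) ρ(|z|+1)`, so both local estimates apply and `B_ρ(z,r)` is
comparable to a `d`-ball of radius `r / ρ(|z|+1)`. -/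
lemma isReference_of_small (hs : IsScale CU CA CB κ n N) (hκ : 1 < κ) {z : X}
    (hz : z ∈ frontier Ω) {r : ℝ} (hr : 0 < r)
    (hrz : 4 * CA ^ 3 * r ≤ (dist z b + 1) * ρ (dist z b + 1)) :
    IsReference (frontier Ω) (toSph h ⁻¹' Metric.ball (toSph h z) r) b ρ CA (scaleConst CA CB n) N
      r z z (r / ρ (dist z b + 1)) (dist z b + 1) := by
  have hz0 : 0 ≤ dist z b := dist_nonneg
  have hN : (1 : ℝ) ≤ 2 ^ N := one_le_pow₀ one_le_two
  have hA := S.condA.one_le S.density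
  have hU := S.uniform.one_le
  have h36 : CA ^ 3 ≤ CA ^ 6 := pow_le_pow_right₀ hA (by norm_num)
  have h3 : 1 ≤ CA ^ 3 := one_le_pow₀ hA
  have hc := S.one_le_scaleConst (n := n)
  have hN' := hs.le_two_pow
  set v := dist z b + 1 with hv
  have hv1 : 0 < v := by linarith
  have hρ : 0 < ρ v := S.density.1 _ hv1
  set s := r / ρ v with hsdef
  have hs0 : 0 < s := by positivity
  have hrs : ρ v * s = r := mul_div_cancel₀ _ hρ.ne'
  have hsv : 4 * CA ^ 3 * s ≤ v := by
    refine le_of_mul_le_mul_left ?_ hρ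
    calc ρ v * (4 * CA ^ 3 * s) = 4 * CA ^ 3 * (ρ v * s) := by ring
      _ ≤ ρ v * v := by rw [hrs]; linarith
  have hsv' : 4 * s ≤ v := by nlinarith
  have hNU : CA ^ 3 * CU ≤ 2 ^ N := by nlinarith
  have hNA : CA ^ 3 ≤ 2 ^ N := by nlinarith
  have h6U : 1 ≤ CA ^ 6 * CU := one_le_mul_of_one_le_of_one_le (h3.trans h36) hU
  have hN2 : (2 : ℝ) ≤ 2 ^ N := by linarith
  have hsN : s / 2 ^ N ≤ s := div_le_self hs0.le hN
  have hv2 : 2 * v ≤ 2 ^ N * v := by gcongr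
  refine ⟨hz, hz, hs0, hv1, by rw [hrs]; nlinarith, by rw [hrs]; nlinarith, fun y hy => ?_, ?_,
    fun y hy hyb => ?_, Or.inl fun y hy => ?_⟩
  · rw [Metric.mem_ball'] at hy
    rw [mem_preimage, Metric.mem_ball']
    have h4 : dist z y * 2 ^ N < s := by rwa [lt_div_iff₀ (by positivity)] at hy
    have h5 : CA ^ 3 * CU * dist z y < s := by
      refine lt_of_le_of_lt ?_ h4
      rw [mul_comm]
      gcongr
    have h6 : CU * dist z y ≤ CA ^ 3 * CU * dist z y := by
      rw [mul_assoc]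
      exact le_mul_of_one_le_left (by positivity) h3
    refine (S.dist_toSph_le_mul_dist h (by linarith)).trans_lt ?_
    calc CA ^ 3 * CU * (ρ v * dist z y) = ρ v * (CA ^ 3 * CU * dist z y) := by ring
      _ < ρ v * s := by gcongr
      _ = r := hrs
  · rw [dist_self]; positivity
  · rw [Metric.mem_ball] at hy
    have h4 := dist_triangle_left z b y
    have h5 := dist_triangle y z b
    have h6 : 2 * (dist y b + 1) ≤ 2 ^ N * (dist y b + 1) := by gcongr
    exact S.condA.pow_add_one_le N (_root_.dist_pos.2 hyb) hv1 (by linarith) (by linarith)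
  · rw [mem_preimage, Metric.mem_ball'] at hy
    have h4 : ρ v * min (dist z y) (v / 2) < ρ v * (CA ^ 3 * s) := by
      refine (S.le_dist_toSph h z y).trans_lt ?_
      calc CA ^ 3 * dist (toSph h z) (toSph h y) < CA ^ 3 * r := by gcongr
        _ = ρ v * (CA ^ 3 * s) := by rw [← hrs]; ring
    have h5 := lt_of_mul_lt_mul_left h4 hρ.le
    -- The second entry `v / 2` of the minimum is excluded by `4 * CA ^ 3 * s ≤ v`.
    have h6 : dist z y < CA ^ 3 * s := by
      rcases min_lt_iff.1 h5 with h | h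
      · exact h
      · linarith
    have h7 := dist_triangle_left z b y
    have h8 := dist_triangle y z b
    rw [dist_comm] at h6
    refine ⟨h6.trans_le (by gcongr), fun hyb => ?_⟩
    have h9 : 2 * (dist y b + 1) ≤ 2 ^ N * (dist y b + 1) := by gcongr
    exact S.condA.le_pow_add_one N (_root_.dist_pos.2 hyb) hv1 (by linarith) (by linarith)

/-- Here `r` is comparable to `(|z|+1) ρ(|z|+1)`, equivalently to the tail at `|z|`. The ball may
stretch to infinity, but the decay of the tail keeps it from coming much closer to `b` than `z` is.
-/
lemma isReference_of_medium (hs : IsScale CU CA CB κ n N) (hκ : 1 < κ) {z : X}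
    (hz : z ∈ frontier Ω) {r : ℝ} (hr : 0 < r)
    (hrz : (dist z b + 1) * ρ (dist z b + 1) ≤ 4 * CA ^ 3 * r)
    (hrt : r ≤ tailConst CA CB n * tail ρ (dist z b)) :
    IsReference (frontier Ω) (toSph h ⁻¹' Metric.ball (toSph h z) r) b ρ CA (scaleConst CA CB n) N
      r z z (dist z b + 1) (dist z b + 1) := by
  have hz0 : 0 ≤ dist z b := dist_nonneg
  have hN : (1 : ℝ) ≤ 2 ^ N := one_le_pow₀ one_le_two
  have hA := S.condA.one_le S.density
  have hB := S.condB.1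
  have hU := S.uniform.one_le
  have hN' := hs.le_two_pow
  have hK := S.one_le_tailConst (n := n)
  have hD := S.one_le_tail_factor
  have htail := tail_le S.density S.condA S.condB hz0
  have htail0 := tail_pos S.density S.condA S.condB hz0
  have h6 : 1 ≤ CA ^ 6 := one_le_pow₀ hA
  have h3 : 1 ≤ CA ^ 3 := one_le_pow₀ hA
  have hdec := hs.decay
  set K := tailConst CA CB n with hKdef
  set D := (CA + 2 * CB) * CA ^ 2 with hDdef
  set v := dist z b + 1 with hv
  have hv1 : 0 < v := by linarith
  have hρ : 0 < ρ v := S.density.1 _ hv1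
  have h6U : 1 ≤ CA ^ 6 * CU := one_le_mul_of_one_le_of_one_le h6 hU
  have hN2 : (2 : ℝ) ≤ 2 ^ N := by linarith
  have hN6 : 4 * (CA ^ 6 * CU) ≤ 2 ^ N := by linarith
  have hc : scaleConst CA CB n = 4 * CA ^ 3 + 2 * K * D * (CA + 2 * CB) := rfl
  have hvN : v / 2 ^ N ≤ v / 2 := by gcongr
  refine ⟨hz, hz, hv1, hv1, ?_, ?_, fun y hy => ?_, ?_, fun y hy hyb => ?_,
    Or.inr ⟨by linarith, rfl, by linarith, fun y hy => ?_⟩⟩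
  · calc r ≤ K * ((CA + 2 * CB) * (v * ρ v)) := hrt.trans (by gcongr)
      _ = K * 1 * (CA + 2 * CB) * (ρ v * v) := by ring
      _ ≤ 2 * K * D * (CA + 2 * CB) * (ρ v * v) := by gcongr; linarith
      _ ≤ scaleConst CA CB n * (ρ v * v) := by
        rw [hc]
        gcongr
        linarith
  · rw [mul_comm]
    refine hrz.trans ?_
    rw [hc]
    gcongr
    have : 0 ≤ 2 * K * D * (CA + 2 * CB) := by positivity
    linarith
  · rw [Metric.mem_ball'] at hy
    rw [mem_preimage, Metric.mem_ball']
    have h4 : dist z y * 2 ^ N < v := by rwa [lt_div_iff₀ (by positivity)] at hy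
    have h5 : 4 * (CA ^ 6 * CU) * dist z y < v := by
      refine lt_of_le_of_lt ?_ h4
      rw [mul_comm]
      gcongr
    have h7 : CU * dist z y ≤ CA ^ 6 * CU * dist z y := by
      rw [mul_assoc]
      exact le_mul_of_one_le_left (by positivity) h6
    have h8 : 0 ≤ CU * dist z y := by positivity
    refine (S.dist_toSph_le_mul_dist h (by linarith)).trans_lt ?_
    -- This is the origin of the term `4 * (CA ^ 6 * CU)` in `IsScale`: one `CA ^ 3` from the local
    -- upper bound, the other from `hrz`.
    have h9 : 4 * CA ^ 3 * (CA ^ 3 * CU * (ρ v * dist z y)) < 4 * CA ^ 3 * r := by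
      calc 4 * CA ^ 3 * (CA ^ 3 * CU * (ρ v * dist z y))
          = (4 * (CA ^ 6 * CU) * dist z y) * ρ v := by ring
        _ < v * ρ v := by gcongr
        _ ≤ _ := hrz
    exact lt_of_mul_lt_mul_left h9 (by positivity)
  · rw [dist_self]; positivity
  · rw [Metric.mem_ball] at hy
    have h4 := dist_triangle_left z b y
    have h5 := dist_triangle y z b
    have h6 : 2 * (dist y b + 1) ≤ 2 ^ N * (dist y b + 1) := by gcongr
    have h7 : 2 * v ≤ 2 ^ N * v := by gcongr
    exact S.condA.pow_add_one_le N (_root_.dist_pos.2 hyb) hv1 (by linarith) (by linarith)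
  · rw [mem_preimage, Metric.mem_ball] at hy
    have h4 := S.tail_le_add_dist_toSph h y z
    have h5 : tail ρ (dist y b) ≤ 4 * D ^ 3 * (1 + K) * tail ρ (dist z b) := by
      calc tail ρ (dist y b) ≤ D ^ 2 * (tail ρ (dist z b) + dist (toSph h y) (toSph h z)) := h4
        _ ≤ D ^ 2 * (tail ρ (dist z b) + K * tail ρ (dist z b)) := by
          gcongr
          exact hy.le.trans hrt
        _ = 1 * D ^ 2 * (1 + K) * tail ρ (dist z b) := by ring
        _ ≤ 4 * D ^ 3 * (1 + K) * tail ρ (dist z b) := by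
          gcongr
          · norm_num
          · norm_num
    exact add_one_le_of_tail_le S.density S.condA S.condB (by positivity) hdec dist_nonneg h5

/-- The parameter `g` is the tail of the centre, zero at infinity. Since `r` exceeds a multiple of
`g`, the ball contains a full neighbourhood of infinity, and the reference ball is centred at `b`
with radius the dyadic `s` for which `tail ρ (s - 1) ≈ r`. -/
lemma exists_isReference_of_large (hs : IsScale CU CA CB κ n N)
    (hκ : UniformlyPerfectWith (frontier Ω) κ) (hub : ¬ Bornology.IsBounded (frontier Ω))
    {ξ : SphSpace h} {r g : ℝ} (hg : 0 ≤ g) (hgr : tailConst CA CB n * g < r)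
    (hξ : ∀ y, dist (toSph h y) ξ ≤ tailConst CA CB n * max (tail ρ (dist y b)) g ∧
      tail ρ (dist y b) ≤ ((CA + 2 * CB) * CA ^ 2) ^ 2 * (g + dist (toSph h y) ξ))
    (hr0 : r ≤ 2 * tailConst CA CB n * tail ρ 0) :
    ∃ z a s v, IsReference (frontier Ω) (toSph h ⁻¹' Metric.ball ξ r) b ρ CA
      (scaleConst CA CB n) N r z a s v := by
  have hA := S.condA.one_le S.density
  have hB := S.condB.1
  have hU := S.uniform.one_le
  have hN' := hs.le_two_pow
  have hK := S.one_le_tailConst (n := n)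
  have hD := S.one_le_tail_factor
  have hdec := hs.decay
  have h6U : 1 ≤ CA ^ 6 * CU := one_le_mul_of_one_le_of_one_le (one_le_pow₀ hA) hU
  have hc : scaleConst CA CB n = 4 * CA ^ 3 + 2 * tailConst CA CB n *
    ((CA + 2 * CB) * CA ^ 2) * (CA + 2 * CB) := rfl
  set K := tailConst CA CB n with hKdef
  set D := (CA + 2 * CB) * CA ^ 2 with hDdef
  have hr : 0 < r := lt_of_le_of_lt (by positivity) hgr
  have hN : (1 : ℝ) ≤ 2 ^ N := one_le_pow₀ one_le_two
  have hex : ∃ k : ℕ, K * tail ρ (2 ^ k - 1) < r := by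
    have h1 : Tendsto (fun k : ℕ => (2 : ℝ) ^ k - 1) atTop atTop :=
      tendsto_atTop_add_const_right _ _ (tendsto_pow_atTop_atTop_of_one_lt one_lt_two)
    have h2 := (S.tendsto_tail.comp h1).const_mul K
    rw [mul_zero] at h2
    exact (h2.eventually_lt_const hr).exists
  -- Take the least admissible `k`. Its predecessor fails, and the tail drops by a bounded factor in
  -- one step, which gives the lower bound on the tail; for `k = 0` the diameter bound `hr0`
  -- replaces the predecessor.
  obtain ⟨k, hk, hkmin⟩ : ∃ k : ℕ, K * tail ρ (2 ^ k - 1) < r ∧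
      r ≤ 2 * K * D * tail ρ (2 ^ k - 1) := by
    classical
    refine ⟨Nat.find hex, Nat.find_spec hex, ?_⟩
    rcases Nat.eq_zero_or_eq_succ_pred (Nat.find hex) with h0 | h0
    · have h1 := tail_nonneg (ρ := ρ) 0
      rw [h0]
      simp only [pow_zero, sub_self]
      calc r ≤ 2 * K * 1 * tail ρ 0 := by linarith
        _ ≤ _ := by gcongr
    · set j := (Nat.find hex).pred with hj
      have h1 := Nat.find_min hex (show j < Nat.find hex by omega)
      have h2 : (1 : ℝ) ≤ 2 ^ j := one_le_pow₀ one_le_two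
      have h3 := tail_le_of_two_mul_add_one S.density S.condA S.condB
        (show (0 : ℝ) ≤ 2 ^ j - 1 by linarith)
      have h4 : (2 : ℝ) * (2 ^ j - 1) + 1 = 2 ^ j.succ - 1 := by rw [pow_succ]; ring
      rw [h4] at h3
      rw [h0]
      have h5 := tail_nonneg (ρ := ρ) (2 ^ j.succ - 1)
      calc r ≤ K * tail ρ (2 ^ j - 1) := not_lt.1 h1
        _ ≤ K * (D * tail ρ (2 ^ j.succ - 1)) := by gcongr
        _ ≤ 2 * (K * (D * tail ρ (2 ^ j.succ - 1))) := by
          have : 0 ≤ K * (D * tail ρ (2 ^ j.succ - 1)) := by positivity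
          linarith
        _ = _ := by ring
  have hs1 : (1 : ℝ) ≤ 2 ^ k := one_le_pow₀ one_le_two
  set s : ℝ := 2 ^ k with hsdef
  have ht0 : 0 ≤ s - 1 := by linarith
  have hs0 : 0 < s := by linarith
  have hρ : 0 < ρ s := S.density.1 _ hs0
  have hup := tail_le S.density S.condA S.condB ht0
  have hlow := le_tail S.density S.condA S.condB ht0
  have htp := tail_pos S.density S.condA S.condB ht0
  rw [sub_add_cancel] at hup hlow
  have hgr' : g ≤ r := (le_mul_of_one_le_left hg hK).trans hgr.le
  -- The boundary point `a` satisfies `2s ≤ |a| < 2κs`. A ball of radius at most `s` about it stays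
  -- at `|y| ≥ s`, where the tail is small enough to lie in `U`.
  obtain ⟨a, ⟨ha1, ha2⟩, haF⟩ := hκ.2 b S.mem_frontier (2 * s) (by linarith) fun hF =>
    hub (Metric.isBounded_ball.subset (inter_eq_left.1 hF))
  rw [Metric.mem_ball] at ha1 ha2
  have hκ1 := hκ.1
  have hball : ∀ y ∈ Metric.ball a (s / 2 ^ N), s ≤ dist y b ∧ dist y b + 1 ≤ 2 ^ N * s := by
    intro y hy
    rw [Metric.mem_ball] at hy
    have h1 : s / 2 ^ N ≤ s := div_le_self hs0.le hN
    have h2 := dist_triangle y a b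
    have h3 := dist_triangle_left a b y
    have h4 : (2 * κ + 2) * s ≤ 2 ^ N * s := by gcongr; linarith
    constructor <;> nlinarith
  refine ⟨b, a, s, s, S.mem_frontier, haF, hs0, hs0, ?_, ?_, fun y hy => ?_, ?_,
    fun y hy hyb => ?_, Or.inr ⟨hs1, rfl, by rw [dist_self]; exact hs0.le, fun y hy => ?_⟩⟩
  · calc r ≤ 2 * K * D * ((CA + 2 * CB) * (s * ρ s)) := hkmin.trans (by gcongr)
      _ = 2 * K * D * (CA + 2 * CB) * (ρ s * s) := by ring
      _ ≤ scaleConst CA CB n * (ρ s * s) := by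
        rw [hc]
        gcongr
        have : 0 ≤ CA ^ 3 := by positivity
        linarith
  · calc ρ s * s ≤ CA * tail ρ (s - 1) := by linarith
      _ ≤ CA * (K * tail ρ (s - 1)) := by
        gcongr
        exact le_mul_of_one_le_left htp.le hK
      _ ≤ CA ^ 3 * r := by
        gcongr
        exact le_self_pow₀ hA (by norm_num)
      _ ≤ scaleConst CA CB n * r := by
        rw [hc]
        gcongr
        have : 0 ≤ 2 * K * D * (CA + 2 * CB) := by positivity
        have : 0 ≤ CA ^ 3 := by positivity
        linarith
  · rw [mem_preimage, Metric.mem_ball]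
    refine (hξ y).1.trans_lt ?_
    rcases max_choice (tail ρ (dist y b)) g with h1 | h1 <;> rw [h1]
    · refine lt_of_le_of_lt ?_ hk
      gcongr
      exact tail_antitone S.density S.condA S.condB ht0 (by linarith [(hball y hy).1])
    · exact hgr
  · have h1 : 2 * κ * s ≤ 2 ^ N * s := by gcongr; linarith
    linarith
  · have h1 := hball y hy
    refine S.condA.pow_add_one_le N (_root_.dist_pos.2 hyb) hs0 h1.2 ?_
    calc s ≤ 1 * (dist y b + 1) := by linarith
      _ ≤ _ := by gcongr
  · rw [mem_preimage, Metric.mem_ball] at hy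
    have h5 : tail ρ (dist y b) ≤ 4 * D ^ 3 * (1 + K) * tail ρ (s - 1) := by
      calc tail ρ (dist y b) ≤ D ^ 2 * (g + dist (toSph h y) ξ) := (hξ y).2
        _ ≤ D ^ 2 * (2 * (2 * K * D * tail ρ (s - 1))) := by
          gcongr
          linarith
        _ = 4 * D ^ 3 * K * tail ρ (s - 1) := by ring
        _ ≤ 4 * D ^ 3 * (1 + K) * tail ρ (s - 1) := by
          gcongr
          linarith
    have h6 := add_one_le_of_tail_le S.density S.condA S.condB (by positivity) hdec
      dist_nonneg h5
    rwa [sub_add_cancel] at h6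

lemma dist_le_tail_zero (hn : 1 + 2 * CU ≤ 2 ^ n) (ξ η : SphSpace h) :
    dist ξ η ≤ tailConst CA CB n * tail ρ 0 := by
  have hdense : DenseRange (sphCoe h) :=
    UniformSpace.Completion.denseRange_coe (α := SphDomain h)
  have hK := S.one_le_tailConst (n := n)
  refine hdense.induction_on₂ (p := fun ξ η => dist ξ η ≤ tailConst CA CB n * tail ρ 0)
    (isClosed_le continuous_dist continuous_const) (fun x y => ?_) ξ η
  rw [← toSph_of_mem h x.2, ← toSph_of_mem h y.2]
  refine (S.dist_toSph_le_tail h hn x y).trans (mul_le_mul_of_nonneg_left ?_ (by linarith))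
  exact tail_antitone S.density S.condA S.condB le_rfl (le_min dist_nonneg dist_nonneg)

/-- The three regimes exhaust all radii for a centre in `∂Ω`; the point at infinity falls under the
large one with `g = 0`. -/
lemma exists_isReference [CompleteSpace X] (hs : IsScale CU CA CB κ n N)
    (hκ : UniformlyPerfectWith (frontier Ω) κ) (hub : ¬ Bornology.IsBounded (frontier Ω))
    {ξ : SphSpace h} (hξ : ξ ∈ sphBoundary h) {r : ℝ} (hr : 0 < r)
    (hdiam : ENNReal.ofReal r < 2 * Metric.ediam (sphBoundary h)) :
    ∃ z a s v, IsReference (frontier Ω) (toSph h ⁻¹' Metric.ball ξ r) b ρ CA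
      (scaleConst CA CB n) N r z a s v := by
  have hK := S.one_le_tailConst (n := n)
  have hr0 : r ≤ 2 * tailConst CA CB n * tail ρ 0 := by
    have h0 := tail_nonneg (ρ := ρ) 0
    have h1 : Metric.ediam (sphBoundary h) ≤ ENNReal.ofReal (tailConst CA CB n * tail ρ 0) :=
      Metric.ediam_le fun x _ y _ => by
        rw [edist_dist]
        exact ENNReal.ofReal_le_ofReal (S.dist_le_tail_zero h hs.uniform_le x y)
    have h2 := hdiam.le.trans (mul_le_mul_right h1 2)
    rw [← ENNReal.ofReal_ofNat, ← ENNReal.ofReal_mul (by norm_num),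
      ENNReal.ofReal_le_ofReal_iff (by positivity)] at h2
    linarith
  rcases S.eq_toSph_or_infinity h hs.uniform_le ξ with ⟨z, rfl⟩ | hinf
  · have hz := (S.toSph_mem_sphBoundary h).1 hξ
    rcases le_total (4 * CA ^ 3 * r) ((dist z b + 1) * ρ (dist z b + 1)) with h1 | h1
    · exact ⟨_, _, _, _, S.isReference_of_small h hs hκ.1 hz hr h1⟩
    rcases le_or_gt r (tailConst CA CB n * tail ρ (dist z b)) with h2 | h2
    · exact ⟨_, _, _, _, S.isReference_of_medium h hs hκ.1 hz hr h1 h2⟩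
    refine S.exists_isReference_of_large h hs hκ hub (tail_nonneg _) h2 (fun y => ⟨?_, ?_⟩) hr0
    · refine (S.dist_toSph_le_tail h hs.uniform_le y z).trans ?_
      gcongr
      rcases min_choice (dist y b) (dist z b) with h3 | h3 <;> rw [h3]
      · exact le_max_left _ _
      · exact le_max_right _ _
    · exact S.tail_le_add_dist_toSph h y z
  · refine S.exists_isReference_of_large h hs hκ hub le_rfl (by simpa using hr)
      (fun y => ⟨?_, ?_⟩) hr0
    · refine (hinf y).1.trans ?_
      gcongr
      exact le_max_left _ _
    · rw [zero_add]
      exact (hinf y).2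

end IsSetting

end Reference

/-! ### Weighted mass of a ball against its reference ball -/

section Weight

variable {X : Type*} [MetricSpace X] [MeasurableSpace X] {F U : Set X} {b : X}
  {ρ : ℝ → ℝ} {CA q : ℝ} {m : Measure X} {D C : ℝ≥0∞}

/-- A measure that is doubling at the points of `F`, has no mass at `b ∈ F` and satisfies the
integral condition with exponent `q`. -/
structure IsBoundaryWeight (F : Set X) (b : X) (ρ : ℝ → ℝ) (q : ℝ) (m : Measure X)
    (D C : ℝ≥0∞) : Prop where
  base_mem : b ∈ F
  doubling : ∀ z ∈ F, ∀ s, 0 < s → m (Metric.ball z (2 * s)) ≤ D * m (Metric.ball z s)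
  ball_ne_top : m (Metric.ball b 1) ≠ ∞
  singleton : m {b} = 0
  integral : ∀ r, 0 < r → ∫⁻ x in (Metric.ball b r)ᶜ, ENNReal.ofReal (ρ (dist x b) ^ q) ∂m
    ≤ C * ENNReal.ofReal (ρ r ^ q) * m (Metric.ball b (r + 1))

/-- The factor `CA ^ (n q)` by which `ρ ^ q` varies when `ρ` varies by `CA ^ n`. -/
noncomputable def powFactor (CA q : ℝ) (n : ℕ) : ℝ≥0∞ := ENNReal.ofReal ((CA ^ n) ^ q)

lemma ofReal_rpow_le (hA : 0 < CA) (hq : 0 ≤ q) {n : ℕ} {x y : ℝ} (hx : 0 ≤ x) (hy : 0 ≤ y)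
    (hxy : x ≤ CA ^ n * y) :
    ENNReal.ofReal (x ^ q) ≤ powFactor CA q n * ENNReal.ofReal (y ^ q) := by
  rw [powFactor, ← ENNReal.ofReal_mul (by positivity), ← Real.mul_rpow (by positivity) hy]
  exact ENNReal.ofReal_le_ofReal (Real.rpow_le_rpow hx hxy hq)

namespace IsBoundaryWeight

variable (W : IsBoundaryWeight F b ρ q m D C)
include W

lemma measure_ball_le_pow {z : X} (hz : z ∈ F) {s : ℝ} (hs : 0 < s) (n : ℕ) :
    m (Metric.ball z (2 ^ n * s)) ≤ D ^ n * m (Metric.ball z s) := by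
  induction n with
  | zero => simp
  | succ n ih =>
    rw [pow_succ', mul_assoc, pow_succ', mul_assoc]
    exact (W.doubling z hz _ (by positivity)).trans (by gcongr)

lemma ae_ne : ∀ᵐ x ∂m, x ≠ b := by
  rw [ae_iff]
  simpa using W.singleton

variable (hρ : IsMetricDensity ρ) (hA : CondA ρ CA) (hq : 0 ≤ q)
include hρ hA hq

lemma setLIntegral_le {n : ℕ} {v : ℝ} (hv : 0 < v) (hU : MeasurableSet U)
    (h : ∀ y ∈ U, y ≠ b → ρ (dist y b) ≤ CA ^ n * ρ v) :
    ∫⁻ x in U, ENNReal.ofReal (ρ (dist x b) ^ q) ∂m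
      ≤ powFactor CA q n * ENNReal.ofReal (ρ v ^ q) * m U := by
  rw [← setLIntegral_const]
  refine setLIntegral_mono_ae' hU (W.ae_ne.mono fun y hyb hyU => ?_)
  exact ofReal_rpow_le hA.1 hq (hρ.1 _ (dist_pos.2 hyb)).le (hρ.1 _ hv).le (h y hyU hyb)

lemma le_setLIntegral {n : ℕ} {v : ℝ} (hv : 0 < v) (hU : MeasurableSet U)
    (h : ∀ y ∈ U, y ≠ b → ρ v ≤ CA ^ n * ρ (dist y b)) :
    ENNReal.ofReal (ρ v ^ q) * m U
      ≤ powFactor CA q n * ∫⁻ x in U, ENNReal.ofReal (ρ (dist x b) ^ q) ∂m := by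
  rw [← setLIntegral_const, ← lintegral_const_mul' _ _ (by rw [powFactor]; exact ENNReal.ofReal_ne_top)]
  refine setLIntegral_mono_ae' hU (W.ae_ne.mono fun y hyb hyU => ?_)
  exact ofReal_rpow_le hA.1 hq (hρ.1 _ hv).le (hρ.1 _ (dist_pos.2 hyb)).le (h y hyU hyb)

variable [BorelSpace X]

/-- The integral condition handles the part outside `B(b,t)` with `t` comparable to `s`. What
remains lies in `B(b,1)` and is nonempty only for bounded `s`, where the density is comparable to `ρ
s`. -/
lemma setLIntegral_far_le {z : X} (hz : z ∈ F) {s : ℝ} (hs : 1 ≤ s) (hzs : dist z b ≤ s) (N : ℕ) :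
    ∫⁻ x in {y | s ≤ 2 ^ N * (dist y b + 1)}, ENNReal.ofReal (ρ (dist x b) ^ q) ∂m
      ≤ (powFactor CA q (N + 2) + C * powFactor CA q (N + 1)) * D ^ 2 *
        (ENNReal.ofReal (ρ s ^ q) * m (Metric.ball z s)) := by
  have hs0 : 0 < s := by linarith
  have hN : (1 : ℝ) ≤ 2 ^ N := one_le_pow₀ one_le_two
  have hmeas : MeasurableSet {y | s ≤ 2 ^ N * (dist y b + 1)} :=
    (isClosed_le (by fun_prop) (by fun_prop)).measurableSet
  set A := {y | s ≤ 2 ^ N * (dist y b + 1)} with hAdef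
  set t := s / 2 ^ (N + 1) with ht
  have ht0 : 0 < t := by positivity
  have hts : 2 ^ (N + 1) * t = s := by rw [ht]; field_simp
  have hts' : t ≤ s := div_le_self hs0.le (one_le_pow₀ one_le_two)
  have hsub : A ⊆ (A ∩ Metric.ball b 1) ∪ (Metric.ball b t)ᶜ := by
    intro y hy
    by_cases h1 : y ∈ Metric.ball b 1
    · exact Or.inl ⟨hy, h1⟩
    · refine Or.inr ?_
      rw [mem_compl_iff, Metric.mem_ball, not_lt] at *
      have h2 : s ≤ 2 ^ N * (dist y b + 1) := hy
      rw [ht, div_le_iff₀ (by positivity), pow_succ]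
      nlinarith
  -- Since `|z| ≤ s`, these balls lie in `B(z, 4s)`, two doublings away.
  have hball : ∀ u, u ≤ 3 * s → m (Metric.ball b u) ≤ D ^ 2 * m (Metric.ball z s) := fun u hu =>
    (measure_mono (Metric.ball_subset_ball' (by rw [dist_comm]; linarith))).trans
      (W.measure_ball_le_pow hz hs0 2)
  have h1 : ∫⁻ x in A ∩ Metric.ball b 1, ENNReal.ofReal (ρ (dist x b) ^ q) ∂m
      ≤ powFactor CA q (N + 2) * ENNReal.ofReal (ρ s ^ q) * (D ^ 2 * m (Metric.ball z s)) := by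
    refine (W.setLIntegral_le hρ hA hq (n := N + 2) hs0
      (hmeas.inter Metric.isOpen_ball.measurableSet) fun y hy hyb => ?_).trans ?_
    · have hy1 : s ≤ 2 ^ N * (dist y b + 1) := hy.1
      have hy2 : dist y b < 1 := hy.2
      refine hA.le_pow_add_one (N + 1) (dist_pos.2 hyb) hs0 ?_ ?_ <;> rw [pow_succ] <;> nlinarith
    · gcongr
      exact (measure_mono inter_subset_right).trans (hball 1 (by linarith))
  have h2 : ∫⁻ x in (Metric.ball b t)ᶜ, ENNReal.ofReal (ρ (dist x b) ^ q) ∂m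
      ≤ C * (powFactor CA q (N + 1) * ENNReal.ofReal (ρ s ^ q)) *
        (D ^ 2 * m (Metric.ball z s)) := by
    refine (W.integral t ht0).trans ?_
    gcongr
    · refine ofReal_rpow_le hA.1 hq (hρ.1 _ ht0).le (hρ.1 _ hs0).le
        (hA.le_pow _ ht0 hs0 ?_ hts.ge)
      exact hts'.trans (le_mul_of_one_le_left hs0.le (one_le_pow₀ one_le_two))
    · exact hball _ (by linarith)
  calc ∫⁻ x in A, ENNReal.ofReal (ρ (dist x b) ^ q) ∂m
      ≤ _ := (lintegral_mono_set hsub).trans (lintegral_union_le _ _ _)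
    _ ≤ _ := add_le_add h1 h2
    _ = _ := by ring

/-- With `s = 1`, `N = 0` and `z = b` the far region is the whole space. -/
lemma lintegral_ne_top (hD : D ≠ ∞) (hC : C ≠ ∞) :
    ∫⁻ x, ENNReal.ofReal (ρ (dist x b) ^ q) ∂m ≠ ∞ := by
  have h1 := W.setLIntegral_far_le hρ hA hq W.base_mem le_rfl (by simp) 0
  have h2 : {y | (1 : ℝ) ≤ 2 ^ 0 * (dist y b + 1)} = univ := by
    ext y
    simp
  rw [h2, Measure.restrict_univ] at h1
  refine ne_top_of_le_ne_top ?_ h1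
  have := W.ball_ne_top
  unfold powFactor
  finiteness

/-- The constant in the comparison of a weighted measure with its reference ball. -/
noncomputable def _root_.Sphericalization.weightConst (CA q : ℝ) (N : ℕ) (D C : ℝ≥0∞) : ℝ≥0∞ :=
  D ^ (2 * N + 1) * powFactor CA q (N + 1) + powFactor CA q (N + 1) * D ^ N +
    (powFactor CA q (N + 2) + C * powFactor CA q (N + 1)) * D ^ 2

variable {c : ℝ} {N : ℕ} {r s v : ℝ} {z a : X} (R : IsReference F U b ρ CA c N r z a s v)
include R

/-- `B(z,s)` is swallowed by `2N+1` doublings of the inner ball, which lies in `U` and carries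
density at least comparable to `ρ v`. -/
lemma reference_le :
    ENNReal.ofReal (ρ v ^ q) * m (Metric.ball z s)
      ≤ weightConst CA q N D C * ∫⁻ x in U, ENNReal.ofReal (ρ (dist x b) ^ q) ∂m := by
  have hs := R.radius_pos
  have h1 : m (Metric.ball z s) ≤ D ^ (2 * N + 1) * m (Metric.ball a (s / 2 ^ N)) := by
    refine le_trans (measure_mono ?_)
      (W.measure_ball_le_pow R.inner_mem (by positivity : 0 < s / 2 ^ N) (2 * N + 1))
    refine Metric.ball_subset_ball' ?_
    have h2 : (2 : ℝ) ^ (2 * N + 1) * (s / 2 ^ N) = 2 * (2 ^ N * s) := by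
      rw [pow_succ, pow_mul']
      field_simp
    rw [h2, dist_comm]
    have h3 : s ≤ 2 ^ N * s := le_mul_of_one_le_left hs.le (one_le_pow₀ one_le_two)
    linarith [R.dist_inner_le]
  calc ENNReal.ofReal (ρ v ^ q) * m (Metric.ball z s)
      ≤ ENNReal.ofReal (ρ v ^ q) * (D ^ (2 * N + 1) * m (Metric.ball a (s / 2 ^ N))) := by gcongr
    _ = D ^ (2 * N + 1) * (ENNReal.ofReal (ρ v ^ q) * m (Metric.ball a (s / 2 ^ N))) := by ring
    _ ≤ D ^ (2 * N + 1) * (powFactor CA q (N + 1) *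
          ∫⁻ x in Metric.ball a (s / 2 ^ N), ENNReal.ofReal (ρ (dist x b) ^ q) ∂m) := by
        refine mul_le_mul_right ?_ _
        exact W.le_setLIntegral hρ hA hq R.level_pos Metric.isOpen_ball.measurableSet R.le_density
    _ ≤ D ^ (2 * N + 1) * (powFactor CA q (N + 1) *
          ∫⁻ x in U, ENNReal.ofReal (ρ (dist x b) ^ q) ∂m) := by
        gcongr
        exact R.inner_subset
    _ ≤ _ := by
        rw [← mul_assoc]
        gcongr
        rw [weightConst, add_assoc]
        exact le_self_add

lemma le_reference (hU : MeasurableSet U) :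
    ∫⁻ x in U, ENNReal.ofReal (ρ (dist x b) ^ q) ∂m
      ≤ weightConst CA q N D C * (ENNReal.ofReal (ρ v ^ q) * m (Metric.ball z s)) := by
  rcases R.upper with h | ⟨h1, rfl, h2, h3⟩
  · calc ∫⁻ x in U, ENNReal.ofReal (ρ (dist x b) ^ q) ∂m
        ≤ powFactor CA q (N + 1) * ENNReal.ofReal (ρ v ^ q) * m U :=
          W.setLIntegral_le hρ hA hq R.level_pos hU fun y hy => (h y hy).2
      _ ≤ powFactor CA q (N + 1) * ENNReal.ofReal (ρ v ^ q) * (D ^ N * m (Metric.ball z s)) := by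
          gcongr
          exact (measure_mono fun y hy => Metric.mem_ball.2 (h y hy).1).trans
            (W.measure_ball_le_pow R.center_mem R.radius_pos N)
      _ = powFactor CA q (N + 1) * D ^ N * (ENNReal.ofReal (ρ v ^ q) * m (Metric.ball z s)) := by
          ring
      _ ≤ _ := by
          gcongr
          rw [weightConst]
          exact le_add_self.trans le_self_add
  · refine (lintegral_mono_set h3).trans
      ((W.setLIntegral_far_le hρ hA hq R.center_mem h1 h2 N).trans ?_)
    gcongr
    rw [weightConst]
    exact le_add_self

end IsBoundaryWeight

/-- Bounding the unrestricted mass of `B(z,2s)` by the restricted mass of `B(z,s)` gives doubling of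
the restriction and also lets the restricted measure stand on the right of the integral condition.
-/
lemma isBoundaryWeight_restrict [BorelSpace X] {A T : Set X} (hb : b ∈ F) (hbA : b ∉ A)
    (hAT : A ⊆ T) {C : ℝ}
    (hD : ∀ z ∈ F, ∀ s, 0 < s → m (Metric.ball z (2 * s)) ≤ D * m.restrict A (Metric.ball z s))
    (hfin : m (Metric.ball b 1) ≠ ∞) (hC : IntegralCond T b m ρ q C) :
    IsBoundaryWeight F b ρ q (m.restrict A) D (ENNReal.ofReal C * D) where
  base_mem := hb
  doubling z hz s hs := (Measure.restrict_apply_le _ _).trans (hD z hz s hs)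
  ball_ne_top := ne_top_of_le_ne_top hfin (Measure.restrict_apply_le _ _)
  singleton := by
    rw [Measure.restrict_apply (measurableSet_singleton b), singleton_inter_eq_empty.2 hbA,
      measure_empty]
  integral r hr := by
    rw [Measure.restrict_restrict Metric.isOpen_ball.measurableSet.compl]
    have h1 : (Metric.ball b r)ᶜ ∩ A ⊆ T \ Metric.ball b r := fun x hx => ⟨hAT hx.2, hx.1⟩
    have h2 : m (Metric.ball b (r + 1)) ≤ D * m.restrict A (Metric.ball b (r + 1)) :=
      (measure_mono (Metric.ball_subset_ball (by linarith))).trans (hD b hb (r + 1) (by linarith))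
    refine (lintegral_mono_set h1).trans ((hC.2 r hr).trans ?_)
    rw [ENNReal.ofReal_mul hC.1.le]
    calc ENNReal.ofReal C * ENNReal.ofReal (ρ r ^ q) * m (Metric.ball b (r + 1))
        ≤ ENNReal.ofReal C * ENNReal.ofReal (ρ r ^ q) *
          (D * m.restrict A (Metric.ball b (r + 1))) := by gcongr
      _ = _ := by ring

end Weight

/-! ### Doubling of the restricted measures -/

section Doubling

variable {X : Type*} [MetricSpace X] [MeasurableSpace X] {μ ν : Measure X} {Ω : Set X} {b : X}
  {ρ : ℝ → ℝ} {CU CA CB Cμ Cθ κ θ : ℝ}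

lemma IsDoublingWith.measure_ball_le_pow (hμ : IsDoublingWith μ Cμ) (x : X) {r : ℝ} (hr : 0 < r)
    (n : ℕ) : μ (Metric.ball x (2 ^ n * r)) ≤ ENNReal.ofReal Cμ ^ n * μ (Metric.ball x r) := by
  induction n with
  | zero => simp
  | succ n ih =>
    rw [pow_succ', mul_assoc, pow_succ', mul_assoc]
    exact (hμ.2 x _ (by positivity)).2.1.trans (by gcongr)

lemma IsDoublingWith.measure_ball_ne_top (hμ : IsDoublingWith μ Cμ) (x : X) {r : ℝ} (hr : 0 < r) :
    μ (Metric.ball x r) ≠ ∞ := by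
  refine ne_top_of_le_ne_top (hμ.2 x r hr).2.2.ne (le_mul_of_one_le_left zero_le ?_)
  exact ENNReal.one_le_ofReal.2 hμ.1

lemma IsDoublingWith.measure_ball_le (hμ : IsDoublingWith μ Cμ) {x y : X} {r s : ℝ} (hs : 0 < s)
    {n : ℕ} (hn : r + dist x y ≤ 2 ^ n * s) :
    μ (Metric.ball x r) ≤ ENNReal.ofReal Cμ ^ n * μ (Metric.ball y s) :=
  (measure_mono (Metric.ball_subset_ball' hn)).trans (hμ.measure_ball_le_pow y hs n)

namespace IsSetting

variable (S : IsSetting Ω b ρ CU CA CB)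
include S

omit [MeasurableSpace X] in
/-- The corkscrew condition. -/
lemma exists_ball_subset (hub : ¬ Bornology.IsBounded (frontier Ω)) (z : X) {s : ℝ} (hs : 0 < s) :
    ∃ y, dist y z < s ∧ Metric.ball y (s / (4 * CU)) ⊆ Metric.ball z s ∩ Ω := by
  have hU := S.uniform.one_le
  have hzc : z ∈ closure Ω := S.closure_eq ▸ mem_univ z
  obtain ⟨x, hx, hzx⟩ := Metric.mem_closure_iff.1 hzc (s / 4) (by linarith)
  -- An unbounded boundary forces `Ω` to leave `B(x,s)`. The uniform curve from `x` to such a `w`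
  -- has length at least `s`, and its point at arc length `s / 4` is the centre of the corkscrew
  -- ball.
  obtain ⟨w, hw, hxw⟩ : ∃ w ∈ Ω, s ≤ dist x w := by
    by_contra! hcon
    refine hub ((Metric.isBounded_ball (x := x) (r := s)).closure.subset
      (frontier_subset_closure.trans (closure_mono fun w hw => ?_)))
    exact Metric.mem_ball'.2 (hcon w hw)
  obtain ⟨L, γ, h, -, hγ⟩ := S.uniform.exists_curve x hx w hw
  have hL : s ≤ L := by
    have := h.dist_le_of_mem ⟨h.length_nonneg, le_rfl⟩
    rw [h.target, dist_comm] at this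
    linarith
  have ht : s / 4 ∈ Icc 0 L := ⟨by linarith, by linarith⟩
  have h1 := hγ _ ht
  rw [min_eq_left (by linarith)] at h1
  have h2 := h.dist_le_of_mem ht
  have h3 : dist (γ (s / 4)) z ≤ s / 4 + s / 4 := by
    linarith [dist_triangle_right (γ (s / 4)) z x]
  have h4 : s / (4 * CU) ≤ s / 4 := by
    gcongr
    linarith
  refine ⟨γ (s / 4), by linarith, fun y hy => ⟨?_, ?_⟩⟩
  · rw [Metric.mem_ball] at *
    linarith [dist_triangle y (γ (s / 4)) z]
  · by_contra hcon
    have h5 := Metric.infDist_le_dist_of_mem (x := γ (s / 4)) (show y ∈ Ωᶜ from hcon)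
    rw [Metric.mem_ball', lt_div_iff₀ (by positivity)] at hy
    nlinarith

lemma measure_ball_le_restrict (hub : ¬ Bornology.IsBounded (frontier Ω))
    (hμ : IsDoublingWith μ Cμ) {j : ℕ} (hj : 12 * CU ≤ 2 ^ j) (z : X) {s : ℝ} (hs : 0 < s) :
    μ (Metric.ball z (2 * s)) ≤ ENNReal.ofReal Cμ ^ j * μ.restrict Ω (Metric.ball z s) := by
  have hU := S.uniform.one_le
  obtain ⟨y, hy, hsub⟩ := S.exists_ball_subset hub z hs
  refine (hμ.measure_ball_le (y := y) (s := s / (4 * CU)) (n := j) (by positivity) ?_).trans ?_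
  · rw [dist_comm, mul_div_assoc', le_div_iff₀ (by positivity)]
    nlinarith
  · refine mul_le_mul_right ?_ _
    exact (measure_mono hsub).trans (Measure.le_restrict_apply _ _)

end IsSetting

-- If `z` is not close to `b`, a ball about `z` itself works. Otherwise uniform perfectness gives a
-- boundary point `a` at distance at least `4` small radii from `z`, hence well away from `b`.
omit [MeasurableSpace X] in
lemma UniformlyPerfectWith.exists_ball_subset {F : Set X} (hκ : UniformlyPerfectWith F κ)
    (hub : ¬ Bornology.IsBounded F) (b : X) {z : X} (hz : z ∈ F) {s : ℝ} (hs : 0 < s) :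
    ∃ a ∈ F, dist a z < s ∧ Metric.ball a (s / (8 * κ)) ⊆ Metric.ball z s \ {b} := by
  have hκ1 := hκ.1
  have h8 : s / (8 * κ) < s / 8 := by
    rw [div_lt_div_iff₀ (by positivity) (by positivity)]
    nlinarith
  by_cases hbz : s / (8 * κ) ≤ dist b z
  · refine ⟨z, hz, by simpa using hs, fun y hy => ⟨Metric.ball_subset_ball (by linarith) hy, ?_⟩⟩
    rintro rfl
    exact absurd hbz (not_le.2 hy)
  · push Not at hbz
    obtain ⟨a, ⟨ha1, ha2⟩, haF⟩ := hκ.2 z hz (s / (2 * κ)) (by positivity) fun hF =>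
      hub (Metric.isBounded_ball.subset (inter_eq_left.1 hF))
    have h2 : κ * (s / (2 * κ)) = s / 2 := by field_simp
    have h4 : s / (2 * κ) = 4 * (s / (8 * κ)) := by field_simp; norm_num
    have h5 : 0 < s / (8 * κ) := by positivity
    rw [Metric.mem_ball, h2] at ha1
    rw [Metric.mem_ball, not_lt, h4] at ha2
    refine ⟨a, haF, by linarith, fun y hy => ⟨?_, ?_⟩⟩
    · rw [Metric.mem_ball] at *
      linarith [dist_triangle y a z]
    · rintro rfl
      rw [Metric.mem_ball] at hy
      linarith [dist_triangle_left a z y]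

variable {F : Set X}

lemma IsCodimensionalWith.bounds_of_not_isBounded (hν : IsCodimensionalWith F μ ν θ Cθ)
    (hub : ¬ Bornology.IsBounded F) {x : X} (hx : x ∈ F) {r : ℝ} (hr : 0 < r) :
    μ (Metric.ball x r) / ENNReal.ofReal (r ^ θ) ≤ ENNReal.ofReal Cθ * ν (Metric.ball x r) ∧
      ν (Metric.ball x r)
        ≤ ENNReal.ofReal Cθ * (μ (Metric.ball x r) / ENNReal.ofReal (r ^ θ)) := by
  have h1 : Metric.ediam F = ∞ := by
    by_contra h
    exact hub (Metric.isBounded_iff_ediam_ne_top.2 h)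
  have h2 := hν.bounds x hx r hr (by rw [h1]; simp)
  refine ⟨?_, h2.2⟩
  have h3 : ENNReal.ofReal Cθ ≠ 0 := (ENNReal.ofReal_pos.2 (by linarith [hν.one_le])).ne'
  exact (ENNReal.inv_mul_le_iff h3 ENNReal.ofReal_ne_top).1 h2.1

/-- Codimensionality transfers doubling from `μ` to `ν`. Passing to a ball that misses `b` avoids
any need to know `ν {b}`. -/
lemma IsCodimensionalWith.measure_ball_le_restrict [BorelSpace X]
    (hν : IsCodimensionalWith F μ ν θ Cθ) (hμ : IsDoublingWith μ Cμ)
    (hκ : UniformlyPerfectWith F κ) (hub : ¬ Bornology.IsBounded F) (hθ : 0 < θ) (b : X)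
    {i : ℕ} (hi : 24 * κ ≤ 2 ^ i) {z : X} (hz : z ∈ F) {s : ℝ} (hs : 0 < s) :
    ν (Metric.ball z (2 * s))
      ≤ ENNReal.ofReal Cθ ^ 2 * ENNReal.ofReal Cμ ^ i *
        ν.restrict (F \ {b}) (Metric.ball z s) := by
  have hκ1 := hκ.1
  obtain ⟨a, haF, haz, hsub⟩ := hκ.exists_ball_subset hub b hz hs
  set t := s / (8 * κ) with ht
  have ht0 : 0 < t := by positivity
  have hts : t ≤ 2 * s := by
    rw [ht, div_le_iff₀ (by positivity)]
    nlinarith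
  have h1 : μ (Metric.ball z (2 * s)) ≤ ENNReal.ofReal Cμ ^ i * μ (Metric.ball a t) := by
    refine hμ.measure_ball_le ht0 ?_
    rw [dist_comm, ht, mul_div_assoc', le_div_iff₀ (by positivity)]
    nlinarith
  have h2 : ν (Metric.ball a t) ≤ ν.restrict (F \ {b}) (Metric.ball z s) := by
    rw [Measure.restrict_apply Metric.isOpen_ball.measurableSet]
    calc ν (Metric.ball a t) ≤ ν (Metric.ball z s ∩ (F \ {b}) ∪ Fᶜ) := by
          refine measure_mono fun y hy => ?_
          by_cases hyF : y ∈ F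
          · exact Or.inl ⟨(hsub hy).1, hyF, (hsub hy).2⟩
          · exact Or.inr hyF
      _ ≤ _ := measure_union_le _ _
      _ = _ := by rw [hν.concentrated, add_zero]
  calc ν (Metric.ball z (2 * s))
      ≤ ENNReal.ofReal Cθ * (μ (Metric.ball z (2 * s)) / ENNReal.ofReal ((2 * s) ^ θ)) :=
        (hν.bounds_of_not_isBounded hub hz (by linarith)).2
    _ ≤ ENNReal.ofReal Cθ * (ENNReal.ofReal Cμ ^ i * μ (Metric.ball a t) /
          ENNReal.ofReal (t ^ θ)) := by gcongr
    _ = ENNReal.ofReal Cθ * ENNReal.ofReal Cμ ^ i *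
          (μ (Metric.ball a t) / ENNReal.ofReal (t ^ θ)) := by
        rw [mul_div_assoc, mul_assoc]
    _ ≤ ENNReal.ofReal Cθ * ENNReal.ofReal Cμ ^ i * (ENNReal.ofReal Cθ *
          ν.restrict (F \ {b}) (Metric.ball z s)) := by
        gcongr
        exact (hν.bounds_of_not_isBounded hub haF ht0).1.trans (by gcongr)
    _ = _ := by ring

end Doubling

/-! ### From reference balls to codimension bounds -/

lemma inv_ofReal_rpow_le {x y c θ : ℝ} (hx : 0 < x) (hy : 0 < y) (hθ : 0 ≤ θ) (hxy : x ≤ c * y) :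
    (ENNReal.ofReal (y ^ θ))⁻¹ ≤ ENNReal.ofReal (c ^ θ) * (ENNReal.ofReal (x ^ θ))⁻¹ := by
  have hc : 0 < c := pos_of_mul_pos_left (hx.trans_le hxy) hy.le
  rw [← ENNReal.ofReal_inv_of_pos (by positivity), ← ENNReal.ofReal_inv_of_pos (by positivity),
    ← ENNReal.ofReal_mul (by positivity)]
  refine ENNReal.ofReal_le_ofReal ?_
  rw [← div_eq_mul_inv, inv_eq_one_div, div_le_div_iff₀ (by positivity) (by positivity), one_mul,
    ← Real.mul_rpow hc.le hy.le]
  exact Real.rpow_le_rpow hx.le hxy hθ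

lemma ofReal_rpow_sub_mul_inv {τ s p θ : ℝ} (hτ : 0 < τ) (hs : 0 < s) :
    ENNReal.ofReal (τ ^ (p - θ)) * (ENNReal.ofReal (s ^ θ))⁻¹
      = ENNReal.ofReal (τ ^ p) * (ENNReal.ofReal ((τ * s) ^ θ))⁻¹ := by
  rw [← ENNReal.ofReal_inv_of_pos (by positivity), ← ENNReal.ofReal_inv_of_pos (by positivity),
    ← ENNReal.ofReal_mul (by positivity), ← ENNReal.ofReal_mul (by positivity)]
  congr 1
  rw [Real.rpow_sub hτ, Real.mul_rpow hτ.le hs.le]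
  field_simp

/-- With `τ = ρ v`, the identity `τ^(p-θ) s^(-θ) = τ^p (τ s)^(-θ)` matches the two weights, and `τ s
≈ r` replaces the scale by `r` at the cost of `c ^ θ`. -/
lemma codimensional_of_reference {p θ τ s r c : ℝ} {I J m n Kμ Kν K : ℝ≥0∞} (hθ : 0 ≤ θ)
    (hτ : 0 < τ) (hs : 0 < s) (hr : 0 < r) (hrc : r ≤ c * (τ * s)) (hcr : τ * s ≤ c * r)
    (hI : ENNReal.ofReal (τ ^ p) * m ≤ Kμ * I) (hI' : I ≤ Kμ * (ENNReal.ofReal (τ ^ p) * m))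
    (hJ : ENNReal.ofReal (τ ^ (p - θ)) * n ≤ Kν * J)
    (hJ' : J ≤ Kν * (ENNReal.ofReal (τ ^ (p - θ)) * n))
    (hn : n ≤ K * (m / ENNReal.ofReal (s ^ θ))) (hm : m / ENNReal.ofReal (s ^ θ) ≤ K * n) :
    I / ENNReal.ofReal (r ^ θ) ≤ Kμ * Kν * K * ENNReal.ofReal (c ^ θ) * J ∧
      J ≤ Kμ * Kν * K * ENNReal.ofReal (c ^ θ) * (I / ENNReal.ofReal (r ^ θ)) := by
  have key := ofReal_rpow_sub_mul_inv (p := p) (θ := θ) hτ hs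
  have hτs : 0 < τ * s := by positivity
  rw [div_eq_mul_inv] at hn hm ⊢
  constructor
  · calc I * (ENNReal.ofReal (r ^ θ))⁻¹
        ≤ Kμ * (ENNReal.ofReal (τ ^ p) * m) *
          (ENNReal.ofReal (c ^ θ) * (ENNReal.ofReal ((τ * s) ^ θ))⁻¹) :=
          mul_le_mul' hI' (inv_ofReal_rpow_le hτs hr hθ hcr)
      _ = Kμ * ENNReal.ofReal (c ^ θ) * m *
          (ENNReal.ofReal (τ ^ p) * (ENNReal.ofReal ((τ * s) ^ θ))⁻¹) := by ring
      _ = Kμ * ENNReal.ofReal (c ^ θ) *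
          (ENNReal.ofReal (τ ^ (p - θ)) * (m * (ENNReal.ofReal (s ^ θ))⁻¹)) := by
          rw [← key]; ring
      _ ≤ Kμ * ENNReal.ofReal (c ^ θ) * (ENNReal.ofReal (τ ^ (p - θ)) * (K * n)) := by gcongr
      _ = Kμ * K * ENNReal.ofReal (c ^ θ) * (ENNReal.ofReal (τ ^ (p - θ)) * n) := by ring
      _ ≤ Kμ * K * ENNReal.ofReal (c ^ θ) * (Kν * J) := by gcongr
      _ = _ := by ring
  · calc J ≤ Kν * (ENNReal.ofReal (τ ^ (p - θ)) * (K * (m * (ENNReal.ofReal (s ^ θ))⁻¹))) :=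
          hJ'.trans (by gcongr)
      _ = Kν * K * m * (ENNReal.ofReal (τ ^ (p - θ)) * (ENNReal.ofReal (s ^ θ))⁻¹) := by ring
      _ = Kν * K * (ENNReal.ofReal (τ ^ p) * m) * (ENNReal.ofReal ((τ * s) ^ θ))⁻¹ := by
          rw [key]; ring
      _ ≤ Kν * K * (Kμ * I) * (ENNReal.ofReal (c ^ θ) * (ENNReal.ofReal (r ^ θ))⁻¹) :=
          mul_le_mul' (mul_le_mul_right hI _) (inv_ofReal_rpow_le hr hτs hθ hrc)
      _ = _ := by ring

/-! ### The sphericalized measures -/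

section Main

variable {X : Type*} [MetricSpace X] [MeasurableSpace X] [BorelSpace X] {μ ν : Measure X}
  {Ω : Set X} {b : X} {ρ : ℝ → ℝ} {CU CA CB Cμ Cθ κ θ p : ℝ}

namespace IsSetting

variable (S : IsSetting Ω b ρ CU CA CB) (h : FiniteDist Ω b ρ)
include S

lemma muSph_apply {B : Set (SphSpace h)} (hB : MeasurableSet B) :
    muSph h μ p B
      = ∫⁻ x in toSph h ⁻¹' B, ENNReal.ofReal (ρ (dist x b) ^ p) ∂(μ.restrict Ω) := by
  have hm := (S.continuous_toSph h).measurable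
  rw [muSph, Measure.map_apply hm hB, withDensity_apply _ (hm hB)]

lemma nuSph_apply {B : Set (SphSpace h)} (hB : MeasurableSet B) :
    nuSph h ν p θ B = ∫⁻ x in toSph h ⁻¹' B, ENNReal.ofReal (ρ (dist x b) ^ (p - θ))
      ∂(ν.restrict (frontier Ω \ {b})) := by
  have hm := (S.continuous_toSph h).measurable
  rw [nuSph, Measure.map_apply hm hB, withDensity_apply _ (hm hB)]

lemma nuSph_compl_sphBoundary [CompleteSpace X] : nuSph h ν p θ (sphBoundary h)ᶜ = 0 := by
  have hB : MeasurableSet (sphBoundary h)ᶜ := by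
    rw [sphBoundary, compl_compl]
    exact (S.isOpen_range_sphCoe h).measurableSet
  rw [S.nuSph_apply h hB, Measure.restrict_restrict ((S.continuous_toSph h).measurable hB)]
  have h1 : toSph h ⁻¹' (sphBoundary h)ᶜ ∩ (frontier Ω \ {b}) = ∅ := by
    ext x
    simp only [mem_inter_iff, mem_preimage, mem_compl_iff, S.toSph_mem_sphBoundary h, Set.mem_sdiff,
      mem_empty_iff_false, iff_false]
    tauto
  rw [h1, Measure.restrict_empty, lintegral_zero_measure]

end IsSetting

end Main

end Sphericalization

/-! ### Assembly of the main theorem -/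

theorem mainTheorem4 (CU Cμ p θ Cθ κ CA CB CC CD : ℝ)
    (hp : 1 ≤ p) (hθ : 0 < θ) (hθp : θ < p) :
    ∃ C : ℝ, 1 ≤ C ∧
      ∀ (X : Type*) [MetricSpace X] [CompleteSpace X] [MeasurableSpace X] [BorelSpace X]
        (μ ν : Measure X) (Ω : Set X) (b : X) (ρ : ℝ → ℝ)
        (hμ : Sphericalization.IsDoublingWith μ Cμ)
        (hΩ : Sphericalization.IsUniformDomainWith Ω CU)
        (hcl : closure Ω = univ)
        (hub : ¬ Bornology.IsBounded (frontier Ω))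
        (hκ : Sphericalization.UniformlyPerfectWith (frontier Ω) κ)
        (hν : Sphericalization.IsCodimensionalWith (frontier Ω) μ ν θ Cθ)
        (hb : b ∈ frontier Ω)
        (hρ : Sphericalization.IsMetricDensity ρ)
        (hA : Sphericalization.CondA ρ CA)
        (hB : Sphericalization.CondB ρ CB)
        (hC : Sphericalization.IntegralCond Ω b μ ρ p CC)
        (hD : Sphericalization.IntegralCond (frontier Ω) b ν ρ (p - θ) CD),
        Sphericalization.IsCodimensionalWith
          (Sphericalization.sphBoundary (Sphericalization.finiteDist hΩ hb hA))
          (Sphericalization.muSph (Sphericalization.finiteDist hΩ hb hA) μ p)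
          (Sphericalization.nuSph (Sphericalization.finiteDist hΩ hb hA) ν p θ) θ C := by
  open Sphericalization in
  -- The constant is chosen before the density. Outside this range of `CA` and `CB` no density
  -- satisfies (A) and (B), and the claim is vacuous.
  by_cases hAB : 1 ≤ CA ∧ 0 < CB
  swap
  · exact ⟨1, le_rfl, fun X _ _ _ _ μ ν Ω b ρ _ _ _ _ _ _ _ hρ hA hB _ _ =>
      absurd ⟨hA.one_le hρ, hB.1⟩ hAB⟩
  obtain ⟨n, N, hs⟩ := exists_isScale (CU := CU) (κ := κ) hAB.1 hAB.2
  obtain ⟨j, hj⟩ := pow_unbounded_of_one_lt (12 * CU) (one_lt_two)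
  obtain ⟨i, hi⟩ := pow_unbounded_of_one_lt (24 * κ) (one_lt_two)
  set Dμ : ℝ≥0∞ := ENNReal.ofReal Cμ ^ j with hDμ
  set Dν : ℝ≥0∞ := ENNReal.ofReal Cθ ^ 2 * ENNReal.ofReal Cμ ^ i with hDν
  have hDμ' : Dμ ≠ ∞ := by finiteness
  have hDν' : Dν ≠ ∞ := by finiteness
  set Kμ := weightConst CA p N Dμ (ENNReal.ofReal CC * Dμ) with hKμ
  set Kν := weightConst CA (p - θ) N Dν (ENNReal.ofReal CD * Dν) with hKν
  -- The sum `Dμ + Dν` serves both comparisons of `μ|Ω` with the restricted `ν`: one uses doubling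
  -- of `μ`, the other doubling of `ν`.
  set K := Kμ * Kν * (ENNReal.ofReal Cθ * (Dμ + Dν)) *
    ENNReal.ofReal (scaleConst CA CB n ^ θ) with hK
  have hKtop : K ≠ ∞ := by
    rw [hK, hKμ, hKν]
    unfold weightConst powFactor
    finiteness
  have hKC : K ≤ ENNReal.ofReal (max 1 K.toReal) := by
    rw [← ENNReal.ofReal_toReal hKtop, ENNReal.toReal_ofReal ENNReal.toReal_nonneg]
    exact ENNReal.ofReal_le_ofReal (le_max_right _ _)
  have hC0 : ENNReal.ofReal (max 1 K.toReal) ≠ 0 :=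
    (ENNReal.ofReal_pos.2 (lt_max_of_lt_left one_pos)).ne'
  refine ⟨max 1 K.toReal, le_max_left _ _, ?_⟩
  intro X _ _ _ _ μ ν Ω b ρ hμ hΩ hcl hub hκ hν hb hρ hA hB hC hD
  have S : IsSetting Ω b ρ CU CA CB := ⟨hΩ, hcl, hb, hρ, hA, hB⟩
  set h := finiteDist hΩ hb hA
  have hμD := fun (z : X) (s : ℝ) (hs : 0 < s) => S.measure_ball_le_restrict hub hμ hj.le z hs
  have hνD := fun (z : X) (hz : z ∈ frontier Ω) (s : ℝ) (hs : 0 < s) =>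
    hν.measure_ball_le_restrict hμ hκ hub hθ b hi.le hz hs
  have hμfin := hμ.measure_ball_ne_top b one_pos
  have hνfin : ν (Metric.ball b 1) ≠ ∞ := by
    refine ne_top_of_le_ne_top ?_ (hν.bounds_of_not_isBounded hub hb one_pos).2
    simp only [Real.one_rpow, ENNReal.ofReal_one, div_one]
    finiteness
  have Wμ : IsBoundaryWeight (frontier Ω) b ρ p (μ.restrict Ω) Dμ (ENNReal.ofReal CC * Dμ) :=
    isBoundaryWeight_restrict hb S.notMem Subset.rfl (fun z _ => hμD z) hμfin hC
  have Wν : IsBoundaryWeight (frontier Ω) b ρ (p - θ) (ν.restrict (frontier Ω \ {b})) Dν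
      (ENNReal.ofReal CD * Dν) :=
    isBoundaryWeight_restrict hb (fun hb' => hb'.2 rfl) sdiff_subset hνD hνfin hD
  have hp0 : 0 ≤ p := by linarith
  have hpθ : 0 ≤ p - θ := by linarith
  have hfinμ : IsFiniteMeasure (muSph h μ p) := ⟨by
    rw [S.muSph_apply h MeasurableSet.univ, preimage_univ, Measure.restrict_univ]
    exact (Wμ.lintegral_ne_top hρ hA hp0 hDμ' (by finiteness)).lt_top⟩
  have hfinν : IsFiniteMeasure (nuSph h ν p θ) := ⟨by
    rw [S.nuSph_apply h MeasurableSet.univ, preimage_univ, Measure.restrict_univ]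
    exact (Wν.lintegral_ne_top hρ hA hpθ hDν' (by finiteness)).lt_top⟩
  refine ⟨le_max_left _ _, inferInstance, inferInstance, S.nuSph_compl_sphBoundary h, ?_⟩
  intro ξ hξ r hr hdiam
  obtain ⟨z, a, s, v, R⟩ := S.exists_isReference h hs hκ hub hξ hr hdiam
  have hB : MeasurableSet (Metric.ball ξ r) := Metric.isOpen_ball.measurableSet
  have hU : MeasurableSet (toSph h ⁻¹' Metric.ball ξ r) := (S.continuous_toSph h).measurable hB
  have hs0 := R.radius_pos
  have hcod := hν.bounds_of_not_isBounded hub R.center_mem hs0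
  have hball : ∀ m : Measure X, m (Metric.ball z s) ≤ m (Metric.ball z (2 * s)) := fun m =>
    measure_mono (Metric.ball_subset_ball (by linarith))
  have hn : ν.restrict (frontier Ω \ {b}) (Metric.ball z s) ≤ ENNReal.ofReal Cθ * (Dμ + Dν) *
      (μ.restrict Ω (Metric.ball z s) / ENNReal.ofReal (s ^ θ)) := by
    calc ν.restrict (frontier Ω \ {b}) (Metric.ball z s) ≤ ν (Metric.ball z s) :=
          Measure.restrict_apply_le _ _
      _ ≤ ENNReal.ofReal Cθ * (Dμ * μ.restrict Ω (Metric.ball z s) / ENNReal.ofReal (s ^ θ)) := by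
          refine hcod.2.trans ?_
          gcongr
          exact (hball μ).trans (hμD z s hs0)
      _ = ENNReal.ofReal Cθ * Dμ * (μ.restrict Ω (Metric.ball z s) / ENNReal.ofReal (s ^ θ)) := by
          rw [mul_div_assoc, mul_assoc]
      _ ≤ _ := by
          gcongr
          exact le_self_add
  have hm : μ.restrict Ω (Metric.ball z s) / ENNReal.ofReal (s ^ θ) ≤
      ENNReal.ofReal Cθ * (Dμ + Dν) * ν.restrict (frontier Ω \ {b}) (Metric.ball z s) := by
    calc μ.restrict Ω (Metric.ball z s) / ENNReal.ofReal (s ^ θ)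
        ≤ μ (Metric.ball z s) / ENNReal.ofReal (s ^ θ) :=
          ENNReal.div_le_div_right (Measure.restrict_apply_le _ _) _
      _ ≤ ENNReal.ofReal Cθ * (Dν * ν.restrict (frontier Ω \ {b}) (Metric.ball z s)) :=
          hcod.1.trans (mul_le_mul_right ((hball ν).trans (hνD z R.center_mem s hs0)) _)
      _ = ENNReal.ofReal Cθ * Dν * ν.restrict (frontier Ω \ {b}) (Metric.ball z s) :=
          (mul_assoc _ _ _).symm
      _ ≤ _ := by
          gcongr
          exact le_add_self
  have hmain := codimensional_of_reference (p := p) hθ.le (hρ.1 v R.level_pos) hs0 hr R.le_mul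
    R.mul_le (Wμ.reference_le hρ hA hp0 R) (Wμ.le_reference hρ hA hp0 R hU)
    (Wν.reference_le hρ hA hpθ R) (Wν.le_reference hρ hA hpθ R hU) hn hm
  rw [← S.muSph_apply h hB, ← S.nuSph_apply h hB] at hmain
  rw [ENNReal.inv_mul_le_iff hC0 ENNReal.ofReal_ne_top]
  exact ⟨hmain.1.trans (by gcongr), hmain.2.trans (by gcongr)⟩
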